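/- Let $\alpha>0$, $C>0$ and $\sigma>0$. For a function $h:\mathbb R\to\mathbb R$ write $h\in\text{Hölder}^{\alpha}(C)$ if $h$ is $k$ times differentiable and $|h^{(k)}(t)-h^{(k)}(t')|\le C|t-t'|^{\alpha-k}$ for all $t,t'\in\mathbb R$, where $k=\lfloor\alpha\rfloor$ is the integer part of $\alpha$. Let $f_h(t_1,t_2)=\mathbf 1_{\{t_2<h(t_1)\}}$ on $[0,1]^2$, and let the Horizon class be $$H^\alpha(C)=\{f_h : h\in \text{Hölder}^{\alpha}(C)\cap\text{Hölder}^{1}(1)\}.$$ For $n\ge 1$ and $0\le i,j\le n-1$ let $x_{i,j}$ be the average of $f$ over the pixel $[\frac in,\frac{i+1}n)\times[\frac jn,\frac{j+1}n)$, and observe $y_{i,j}=x_{i,j}+z_{i,j}$, where the $z_{i,j}$ are i.i.d. $N(0,\sigma^2)$. For $\tau>0$ and an integer $\Delta\ge 0$ the semi-oracle Yaroslavsky filter (SYF) is $$\hat f^{SY}_{\Delta,\tau}(i,j)=\frac{\sum_{m=i-\Delta}^{i+\Delta}\sum_{\ell=j-\Delta}^{j+\Delta} w_{i,j}(m,\ell)\,y_{m,\ell}}{\sum_{m=i-\Delta}^{i+\Delta}\sum_{\ell=j-\Delta}^{j+\Delta}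 w_{i,j}(m,\ell)},\qquad w_{i,j}(m,\ell)=e^{-(y_{m,\ell}-x_{i,j})^2/(2\tau^2)},$$ where at the image boundary either $y$ is extended periodically or the sums are restricted to the pixels of the image. Its risk is $R_n(f,\hat f^{SY}_{\Delta,\tau})=\mathbb E\big(\frac1{n^2}\sum_{i,j}(x_{i,j}-\hat f^{SY}_{\Delta,\tau}(i,j))^2\big)$. Let the range $T\subset(0,\infty)$ of the parameter $\tau$ be any fixed (independent of $n$) nonempty set that is bounded away from $0$; for instance $T=\{\tau\}$ for a fixed $\tau>0$, or $T=[\tau_0,\infty)$. Then $$\inf_{\tau\in T,\ \Delta\ge 0}\ \sup_{f\in H^\alpha(C)} R_n(f,\hat f^{SY}_{\Delta,\tau})\asymp n^{-2/3},$$ that is, there are constants $c_1,c_2>0$ and $n_0$, depending only on $\alpha,C,\sigma,T$, such that the left side lies between $c_1n^{-2/3}$ and $c_2n^{-2/3}$ for all $n>n_0$. This holds for either boundary convention, and whether, at integers $a$, $\lfloor a\rfloor$ is read as $a$ or as the largest integer strictly less than $a$ (so that $\text{Hölder}^1(1)$ consists of the $1$-Lipschitz functions). -/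

import Mathlib

open MeasureTheory ProbabilityTheory
open scoped ENNReal NNReal

noncomputable section

namespace HorizonDenoising

/-- The two readings of the integer part used as the order of differentiation in the Hölder
condition; they differ only at integers. -/
inductive IntegerPart
  | floor
  | strict

/-- `floor`: the largest integer `≤ a`.  `strict`: the largest integer `< a` (for `a > 0`), so that
the Hölder class of order `1` is a class of Lipschitz functions. -/
def IntegerPart.eval : IntegerPart → ℝ → ℕ
  | .floor, a => ⌊a⌋₊
  | .strict, a => ⌈a⌉₊ - 1

/-- `h` belongs to `Hölder^α(C)`: it is `k` times differentiable on `ℝ`, where `k` is the integer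
part of `α`, and `|h^(k)(t) - h^(k)(t')| ≤ C |t - t'|^(α - k)`. -/
def IsHolder (ip : IntegerPart) (α C : ℝ) (h : ℝ → ℝ) : Prop :=
  (∀ m < ip.eval α, Differentiable ℝ (iteratedDeriv m h)) ∧
    ∀ t t' : ℝ, |iteratedDeriv (ip.eval α) h t - iteratedDeriv (ip.eval α) h t'| ≤
      C * |t - t'| ^ (α - (ip.eval α : ℝ))

/-- The image `f_h(t₁, t₂) = 1_{t₂ < h(t₁)}` (only its values on the unit square are ever used). -/
def horizonImage (h : ℝ → ℝ) : ℝ × ℝ → ℝ :=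
  Set.indicator {t : ℝ × ℝ | t.2 < h t.1} (fun _ => 1)

/-- The Horizon class `H^α(C)`. -/
def horizonClass (ip : IntegerPart) (α C : ℝ) : Set (ℝ × ℝ → ℝ) :=
  {f | ∃ h : ℝ → ℝ, IsHolder ip α C h ∧ IsHolder ip 1 1 h ∧ f = horizonImage h}

/-- The pixel `[i/n, (i+1)/n) × [j/n, (j+1)/n)`, for `0 ≤ i, j ≤ n - 1`. -/
def pixel (n : ℕ) (p : Fin n × Fin n) : Set (ℝ × ℝ) :=
  Set.Ico ((p.1 : ℝ) / n) (((p.1 : ℝ) + 1) / n) ×ˢ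
    Set.Ico ((p.2 : ℝ) / n) (((p.2 : ℝ) + 1) / n)

/-- The noise-free pixel values: `x_{i,j}` is the average of `f` over the pixel `(i, j)`. -/
def pixelMean (n : ℕ) (f : ℝ × ℝ → ℝ) (p : Fin n × Fin n) : ℝ :=
  ⨍ t in pixel n p, f t

/-- The law of the noise: i.i.d. `N(0, σ²)` variables, one for each pixel. -/
def noise (n : ℕ) (σ : ℝ≥0) : Measure (Fin n × Fin n → ℝ) :=
  Measure.pi fun _ => gaussianReal 0 (σ ^ 2)

/-- The risk `E (n⁻² ∑ (x_{i,j} - est_{i,j}(y))²)` of an estimator at `f`, where `y = x + z`. -/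
def risk (n : ℕ) (σ : ℝ≥0) (f : ℝ × ℝ → ℝ)
    (est : (Fin n × Fin n → ℝ) → Fin n × Fin n → ℝ) : ℝ≥0∞ :=
  ∫⁻ z, ENNReal.ofReal
    (1 / (n : ℝ) ^ 2 * ∑ p, (pixelMean n f p - est (pixelMean n f + z) p) ^ 2) ∂(noise n σ)

/-- What happens to neighbourhoods that leave the image: either the image is extended
periodically, or the neighbourhood is intersected with the image. -/
inductive Boundary
  | periodic
  | truncated

/-- The coordinate `i + d` modulo `n`. -/
def shift {n : ℕ} (i : Fin n) (d : ℤ) : Fin n :=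
  ⟨(((i : ℤ) + d) % (n : ℤ)).toNat, by
    have hn : (0 : ℤ) < n := by exact_mod_cast i.pos
    have h0 := Int.emod_nonneg ((i : ℤ) + d) hn.ne'
    have h1 := Int.emod_lt_of_pos ((i : ℤ) + d) hn
    omega⟩

/-- The `Δ`-neighbourhood of the pixel `p`, as the set of the displacements `(m, ℓ) - p` of its
members. -/
def window {n : ℕ} (b : Boundary) (Δ : ℕ) (p : Fin n × Fin n) : Finset (ℤ × ℤ) :=
  match b with
  | .periodic => Finset.Icc (-(Δ : ℤ)) Δ ×ˢ Finset.Icc (-(Δ : ℤ)) Δ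
  | .truncated =>
      (Finset.Icc (-(Δ : ℤ)) Δ ×ˢ Finset.Icc (-(Δ : ℤ)) Δ).filter fun d =>
        (0 ≤ (p.1 : ℤ) + d.1 ∧ (p.1 : ℤ) + d.1 < n) ∧ (0 ≤ (p.2 : ℤ) + d.2 ∧ (p.2 : ℤ) + d.2 < n)

/-- The semi-oracle weight `exp (-(y_{m,ℓ} - x_{i,j})² / (2τ²))`. -/
def semiOracleWeight (τ xp yq : ℝ) : ℝ :=
  Real.exp (-(yq - xp) ^ 2 / (2 * τ ^ 2))

/-- The semi-oracle Yaroslavsky filter with parameters `Δ` and `τ`. It knows the noise-free value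
`x p` of the pixel `p` that it estimates from the noisy image `y`. -/
def semiOracleYF {n : ℕ} (b : Boundary) (Δ : ℕ) (τ : ℝ) (x y : Fin n × Fin n → ℝ)
    (p : Fin n × Fin n) : ℝ :=
  (∑ d ∈ window b Δ p,
      semiOracleWeight τ (x p) (y (shift p.1 d.1, shift p.2 d.2)) *
        y (shift p.1 d.1, shift p.2 d.2)) /
    ∑ d ∈ window b Δ p, semiOracleWeight τ (x p) (y (shift p.1 d.1, shift p.2 d.2))

/-- `u(n) ≍ g(n)` as `n → ∞`. -/
def SameOrder (u : ℕ → ℝ≥0∞) (g : ℕ → ℝ) : Prop :=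
  ∃ c₁ c₂ : ℝ, 0 < c₁ ∧ 0 < c₂ ∧ ∃ n₀ : ℕ, ∀ n > n₀,
    ENNReal.ofReal (c₁ * g n) ≤ u n ∧ u n ≤ ENNReal.ofReal (c₂ * g n)

end HorizonDenoising

end

namespace HorizonDenoising

/-! Subtracting the true value inside the weighted mean shows that the error at a pixel is, up to
sign, `∑ kern τ u / ∑ exp (-u² / (2τ²))`, where `u` runs over the deviations of the noisy neighbours
from that value (`semiOracleYF_error_sq`). The kernel is bounded and odd, so it has mean zero at a
centred Gaussian and positive mean at a Gaussian of mean one. Write `N` for the number of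
displacements in the window.

Lower bound. The weights are at most 1, so the squared error is at least `(∑ kern)² / N²`. On the
empty image its mean is at least of order `1 / N`, hence of order `(2Δ+1)⁻²`
(`le_risk_empty_image`). For a horizontal edge, pixels within about `Δ/2` above it have a fixed
proportion of neighbours of value 1, which gives a bias of constant order
(`le_risk_horizontal_edge`). If `Δ < n^(1/3)` the variance is already of order `n^(-2/3)`; otherwise
about `n^(1/3)/2` of the `n` rows carry the bias, with the same result. Monotonicity in `τ` reduces
all kernel moments to the smallest bandwidth `τ₀`.

Upper bound. Fix one `τ` and take `Δ = ⌈n^(1/3)⌉`. Where the image is constant on the window, Jensen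
bounds the random denominator below by `N exp (-∑ u² / (2τ²N))`. Its inverse square is a product
over the pixels, even in each noise variable, so the cross terms of `(∑ kern)²` still integrate to
zero and the diagonal leaves `O(1/N)` (`integral_sq_sum_kern_mul_prod_le`). At all other pixels the
mean squared error is at most `σ² + 1`, by Cauchy–Schwarz and Chebyshev's sum inequality. There are
only `O(Δn)` of them: those near the border, and those whose window the horizon crosses
(`card_crosses_le`). -/

/-- The function `u ↦ u exp (-u² / (2τ²))`: a deviation times its semi-oracle weight. -/
noncomputable def kern (τ u : ℝ) : ℝ := Real.exp (-u ^ 2 / (2 * τ ^ 2)) * u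

lemma kern_neg (τ u : ℝ) : kern τ (-u) = -kern τ u := by simp [kern]

lemma continuous_kern (τ : ℝ) : Continuous (kern τ) := by
  unfold kern; fun_prop

lemma abs_kern_le_abs (τ u : ℝ) : |kern τ u| ≤ |u| := by
  rw [kern, abs_mul, Real.abs_exp]
  refine mul_le_of_le_one_left (abs_nonneg _) (Real.exp_le_one_iff.2 ?_)
  exact div_nonpos_of_nonpos_of_nonneg (by nlinarith [sq_nonneg u]) (by positivity)

/-- The inequality `1 + x ≤ exp x` at `x = (u/τ)²`. Boundedness makes every moment of sums of
kernels finite. -/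
lemma abs_kern_le {τ : ℝ} (hτ : 0 < τ) (u : ℝ) : |kern τ u| ≤ τ := by
  have h1 : (u / τ) ^ 2 ≤ Real.exp (u ^ 2 / (2 * τ ^ 2)) ^ 2 := by
    rw [← Real.exp_nat_mul]
    refine le_trans ?_ (Real.add_one_le_exp _)
    have : ((2 : ℕ) : ℝ) * (u ^ 2 / (2 * τ ^ 2)) = (u / τ) ^ 2 := by
      push_cast; field_simp
    rw [this]; linarith
  have h2 := abs_le_of_sq_le_sq h1 (Real.exp_pos _).le
  have h3 : |u| ≤ τ * Real.exp (u ^ 2 / (2 * τ ^ 2)) := by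
    rw [abs_div, abs_of_pos hτ, div_le_iff₀ hτ] at h2
    linarith
  rw [kern, abs_mul, Real.abs_exp, neg_div, Real.exp_neg, inv_mul_le_iff₀ (Real.exp_pos _)]
  linarith

/-- The source of uniformity over the bandwidths: lower bounds at `τ₀` persist for every larger `τ`.
-/
lemma exp_neg_sq_div_mono {τ₀ τ : ℝ} (h₀ : 0 < τ₀) (h : τ₀ ≤ τ) (u : ℝ) :
    Real.exp (-u ^ 2 / (2 * τ₀ ^ 2)) ≤ Real.exp (-u ^ 2 / (2 * τ ^ 2)) := by
  rw [Real.exp_le_exp, neg_div, neg_div, neg_le_neg_iff]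
  gcongr

lemma kern_sq_mono {τ₀ τ : ℝ} (h₀ : 0 < τ₀) (h : τ₀ ≤ τ) (u : ℝ) :
    kern τ₀ u ^ 2 ≤ kern τ u ^ 2 := by
  simp only [kern, mul_pow]
  have := exp_neg_sq_div_mono h₀ h u
  gcongr

/-! ### Gaussian moments of the kernel and of the exponential tilt. -/

section Gaussian

variable {v : ℝ≥0}

lemma integral_gaussianReal_comp_neg (φ : ℝ → ℝ) :
    ∫ z, φ (-z) ∂gaussianReal 0 v = ∫ z, φ z ∂gaussianReal 0 v := by
  have h := (MeasurableEquiv.neg ℝ).measurableEmbedding.integral_map (μ := gaussianReal 0 v) φ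
  have h2 : (gaussianReal 0 v).map (MeasurableEquiv.neg ℝ) = gaussianReal 0 v := by
    have := gaussianReal_map_neg (μ := 0) (v := v)
    rw [neg_zero] at this
    exact this
  rw [h2] at h
  exact h.symm

lemma integral_gaussianReal_of_odd {φ : ℝ → ℝ} (hφ : ∀ z, φ (-z) = -φ z) :
    ∫ z, φ z ∂gaussianReal 0 v = 0 := by
  have h := integral_gaussianReal_comp_neg (v := v) φ
  simp_rw [hφ, integral_neg] at h
  linarith

lemma integrable_sq_gaussianReal : Integrable (fun z : ℝ => z ^ 2) (gaussianReal 0 v) :=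
  (memLp_id_gaussianReal' (μ := 0) (v := v) 2 (by simp)).integrable_sq

lemma integrable_id_gaussianReal : Integrable (fun z : ℝ => z) (gaussianReal 0 v) :=
  (memLp_id_gaussianReal' (μ := 0) (v := v) 1 (by simp)).integrable le_rfl

lemma integral_sq_gaussianReal : ∫ z : ℝ, z ^ 2 ∂gaussianReal 0 v = v := by
  have h := variance_fun_id_gaussianReal (μ := 0) (v := v)
  rw [variance_eq_integral (by fun_prop)] at h
  simpa using h

lemma integrable_of_abs_le {Ω : Type*} [MeasurableSpace Ω] {μ : Measure Ω} [IsFiniteMeasure μ]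
    {φ : Ω → ℝ} (hφ : AEStronglyMeasurable φ μ) {K : ℝ} (hK : ∀ z, |φ z| ≤ K) :
    Integrable φ μ :=
  Integrable.of_bound hφ K (Filter.Eventually.of_forall hK)

lemma integrable_kern_sq (τ : ℝ) : Integrable (fun z => kern τ z ^ 2) (gaussianReal 0 v) := by
  refine integrable_sq_gaussianReal.mono' (by
    have := continuous_kern τ
    fun_prop) (Filter.Eventually.of_forall fun z => ?_)
  rw [Real.norm_eq_abs, abs_pow, ← sq_abs z]
  exact pow_le_pow_left₀ (abs_nonneg _) (abs_kern_le_abs τ z) 2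

lemma integral_pos_of_pos_off_zero (hv : v ≠ 0) {φ : ℝ → ℝ} (h0 : ∀ z, 0 ≤ φ z)
    (hpos : ∀ z, z ≠ 0 → 0 < φ z) (hi : Integrable φ (gaussianReal 0 v)) :
    0 < ∫ z, φ z ∂gaussianReal 0 v := by
  rw [integral_pos_iff_support_of_nonneg h0 hi]
  have hsub : ({0} : Set ℝ)ᶜ ⊆ Function.support φ := fun z hz => (hpos z hz).ne'
  refine lt_of_lt_of_le ?_ (measure_mono hsub)
  have := nullSingletonClass_gaussianReal (μ := 0) hv
  rw [prob_compl_eq_one_sub (measurableSet_singleton 0), measure_singleton]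
  simp

/-- The second moment of the kernel is bounded below for large bandwidths. -/
lemma exists_le_integral_kern_sq (hv : v ≠ 0) {τ₀ : ℝ} (h₀ : 0 < τ₀) :
    ∃ c > 0, ∀ τ ≥ τ₀, c ≤ ∫ z, kern τ z ^ 2 ∂gaussianReal 0 v := by
  refine ⟨∫ z, kern τ₀ z ^ 2 ∂gaussianReal 0 v,
    integral_pos_of_pos_off_zero hv (fun z => sq_nonneg _) (fun z hz => ?_)
      (integrable_kern_sq _), fun τ hτ => ?_⟩
  · exact sq_pos_of_ne_zero (mul_ne_zero (Real.exp_pos _).ne' hz)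
  · exact integral_mono (integrable_kern_sq _) (integrable_kern_sq _)
      fun z => kern_sq_mono h₀ hτ z

/-- The likelihood ratio of a unit shift; its part odd in `u` is what produces the `sinh` below. -/
lemma gaussianPDFReal_sub_one (hv : v ≠ 0) (u : ℝ) :
    gaussianPDFReal 0 v (u - 1) =
      gaussianPDFReal 0 v u * (Real.exp (-(1 / (2 * v))) * Real.exp (u * (1 / v))) := by
  have hv' : (v : ℝ) ≠ 0 := by exact_mod_cast hv
  simp only [gaussianPDFReal_def]
  rw [← Real.exp_add, mul_assoc _ (Real.exp _), ← Real.exp_add]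
  congr 2
  field_simp
  ring

/-- The folded form of the mean of an odd function of a unit-mean Gaussian variable. -/
lemma integral_odd_add_one (hv : v ≠ 0) {φ : ℝ → ℝ} (hodd : ∀ z, φ (-z) = -φ z)
    (hi : ∀ t : ℝ, Integrable (fun z => φ z * Real.exp (z * t)) (gaussianReal 0 v)) :
    ∫ z, φ (z + 1) ∂gaussianReal 0 v =
      Real.exp (-(1 / (2 * v))) * ∫ z, φ z * Real.sinh (z * (1 / v)) ∂gaussianReal 0 v := by
  have h1 : ∫ z, φ (z + 1) ∂gaussianReal 0 v =
      Real.exp (-(1 / (2 * v))) * ∫ z, φ z * Real.exp (z * (1 / v)) ∂gaussianReal 0 v := by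
    rw [← integral_const_mul, integral_gaussianReal_eq_integral_smul hv,
      integral_gaussianReal_eq_integral_smul hv,
      ← integral_sub_right_eq_self (fun z => gaussianPDFReal 0 v z • φ (z + 1)) (1 : ℝ)]
    refine integral_congr_ae (Filter.Eventually.of_forall fun u => ?_)
    simp only [smul_eq_mul, sub_add_cancel]
    rw [gaussianPDFReal_sub_one hv]
    ring
  have h2 := integral_gaussianReal_comp_neg (v := v) fun z => φ z * Real.exp (z * (1 / v))
  simp only [hodd] at h2
  have h3 : ∀ z : ℝ, -φ z * Real.exp (-z * (1 / v)) = -(φ z * Real.exp (z * (-(1 / v)))) := by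
    intro z; rw [neg_mul, neg_mul, mul_neg]
  simp only [h3, integral_neg] at h2
  rw [h1]
  congr 1
  have h4 : ∀ z : ℝ, φ z * Real.sinh (z * (1 / v)) =
      (φ z * Real.exp (z * (1 / v)) - φ z * Real.exp (z * (-(1 / v)))) / 2 := by
    intro z; rw [Real.sinh_eq, mul_neg]; ring
  simp only [h4]
  rw [integral_div, integral_sub (hi _) (hi _)]
  linarith

lemma integrable_kern_mul_exp {τ : ℝ} (hτ : 0 < τ) (t : ℝ) :
    Integrable (fun z => kern τ z * Real.exp (z * t)) (gaussianReal 0 v) := by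
  have h := (integrable_exp_mul_gaussianReal (μ := 0) (v := v) t).const_mul τ
  refine h.mono' (by
    have := continuous_kern τ
    fun_prop) (Filter.Eventually.of_forall fun z => ?_)
  rw [Real.norm_eq_abs, abs_mul, Real.abs_exp, mul_comm z t]
  exact mul_le_mul_of_nonneg_right (abs_kern_le hτ z) (Real.exp_pos _).le

lemma integrable_kern_mul_sinh {τ : ℝ} (hτ : 0 < τ) (t : ℝ) :
    Integrable (fun z => kern τ z * Real.sinh (z * t)) (gaussianReal 0 v) := by
  refine (((integrable_kern_mul_exp hτ t).sub (integrable_kern_mul_exp hτ (-t))).div_const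
    2).congr (Filter.Eventually.of_forall fun z => ?_)
  simp only [Pi.sub_apply]
  rw [Real.sinh_eq, mul_neg]; ring

lemma mul_sinh_nonneg {t : ℝ} (ht : 0 < t) (z : ℝ) : 0 ≤ z * Real.sinh (z * t) := by
  rcases le_total 0 z with hz | hz
  · exact mul_nonneg hz (Real.sinh_nonneg_iff.2 (by positivity))
  · exact mul_nonneg_of_nonpos_of_nonpos hz
      (Real.sinh_nonpos_iff.2 (mul_nonpos_of_nonpos_of_nonneg hz ht.le))

/-- The kernel has a mean bounded below at a deviation with unit mean. -/
lemma exists_le_integral_kern_add_one (hv : v ≠ 0) {τ₀ : ℝ} (h₀ : 0 < τ₀) :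
    ∃ c > 0, ∀ τ ≥ τ₀, c ≤ ∫ z, kern τ (z + 1) ∂gaussianReal 0 v := by
  have ht : (0 : ℝ) < 1 / v := by
    have : (0 : ℝ) < v := by exact_mod_cast pos_iff_ne_zero.2 hv
    positivity
  refine ⟨Real.exp (-(1 / (2 * v))) *
      ∫ z, kern τ₀ z * Real.sinh (z * (1 / v)) ∂gaussianReal 0 v,
    mul_pos (Real.exp_pos _) (integral_pos_of_pos_off_zero hv (fun z => ?_) (fun z hz => ?_)
      (integrable_kern_mul_sinh h₀ _)), fun τ hτ => ?_⟩
  · rw [kern, mul_assoc]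
    exact mul_nonneg (Real.exp_pos _).le (mul_sinh_nonneg ht z)
  · rw [kern, mul_assoc]
    refine mul_pos (Real.exp_pos _) (lt_of_le_of_ne (mul_sinh_nonneg ht z) (Ne.symm ?_))
    exact mul_ne_zero hz (by simp [Real.sinh_eq_zero, hz, hv])
  · have hτ' : 0 < τ := h₀.trans_le hτ
    -- `kern τ (z + 1)` changes sign, so it is not monotone in `τ`; the folded integrand `kern τ z *
    -- sinh` is nonnegative and monotone in `τ`.
    rw [integral_odd_add_one hv (kern_neg τ) (integrable_kern_mul_exp hτ')]
    refine mul_le_mul_of_nonneg_left ?_ (Real.exp_pos _).le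
    refine integral_mono (integrable_kern_mul_sinh h₀ _) (integrable_kern_mul_sinh hτ' _)
      fun z => ?_
    simp only [kern, mul_assoc]
    exact mul_le_mul_of_nonneg_right (exp_neg_sq_div_mono h₀ hτ z) (mul_sinh_nonneg ht z)

/-- Small exponential moments of the square of a Gaussian variable. -/
lemma exists_integral_exp_sq_le :
    ∃ s₀ > 0, ∃ B ≥ 0, ∀ s, 0 ≤ s → s ≤ s₀ →
      Integrable (fun z => Real.exp (s * z ^ 2)) (gaussianReal 0 v) ∧
        ∫ z, Real.exp (s * z ^ 2) ∂gaussianReal 0 v ≤ Real.exp (s * B) := by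
  -- Fernique's theorem.
  obtain ⟨K, hK, hi⟩ := IsGaussian.exists_integrable_exp_sq (gaussianReal 0 v)
  simp only [Real.norm_eq_abs, sq_abs] at hi
  have hpt : ∀ s, s ≤ K / 2 → ∀ z : ℝ,
      z ^ 2 * Real.exp (s * z ^ 2) ≤ 2 / K * Real.exp (K * z ^ 2) := by
    intro s hs z
    have h1 : K / 2 * z ^ 2 ≤ Real.exp (K / 2 * z ^ 2) := by
      linarith [Real.add_one_le_exp (K / 2 * z ^ 2)]
    have h2 : Real.exp (s * z ^ 2) ≤ Real.exp (K / 2 * z ^ 2) := by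
      rw [Real.exp_le_exp]; gcongr
    have h3 : Real.exp (K * z ^ 2) = Real.exp (K / 2 * z ^ 2) * Real.exp (K / 2 * z ^ 2) := by
      rw [← Real.exp_add]; ring_nf
    have h4 : z ^ 2 = 2 / K * (K / 2 * z ^ 2) := by field_simp
    rw [h3]
    calc z ^ 2 * Real.exp (s * z ^ 2)
        = 2 / K * ((K / 2 * z ^ 2) * Real.exp (s * z ^ 2)) := by rw [← mul_assoc, ← h4]
      _ ≤ _ := by gcongr
  have hexp : ∀ s, s ≤ K / 2 → Integrable (fun z => Real.exp (s * z ^ 2)) (gaussianReal 0 v) := by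
    intro s hs
    refine hi.mono' (by fun_prop) (Filter.Eventually.of_forall fun z => ?_)
    rw [Real.norm_eq_abs, Real.abs_exp, Real.exp_le_exp]
    have : s ≤ K := by linarith
    gcongr
  have hsq : Integrable (fun z => z ^ 2 * Real.exp (K / 2 * z ^ 2)) (gaussianReal 0 v) := by
    refine (hi.const_mul (2 / K)).mono' (by fun_prop) (Filter.Eventually.of_forall fun z => ?_)
    rw [Real.norm_eq_abs, abs_of_nonneg (by positivity)]
    exact hpt _ le_rfl z
  -- Half of the exponent `K` is kept to absorb the factor `z²`. A bound `exp (s * B)`, rather than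
  -- a constant, stays bounded when `s` is of order `1/N` and `N` factors are multiplied.
  refine ⟨K / 2, by positivity, ∫ z, z ^ 2 * Real.exp (K / 2 * z ^ 2) ∂gaussianReal 0 v,
    integral_nonneg fun z => by positivity, fun s hs0 hs => ⟨hexp s hs, ?_⟩⟩
  calc ∫ z, Real.exp (s * z ^ 2) ∂gaussianReal 0 v
      ≤ ∫ z, (1 + s * (z ^ 2 * Real.exp (K / 2 * z ^ 2))) ∂gaussianReal 0 v := by
        refine integral_mono (hexp s hs) ((integrable_const _).add (hsq.const_mul s)) fun z => ?_
        have h2 := Real.add_one_le_exp (-(s * z ^ 2))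
        have h3 : Real.exp (s * z ^ 2) * Real.exp (-(s * z ^ 2)) = 1 := by
          rw [← Real.exp_add]; simp
        have h4 : Real.exp (s * z ^ 2) ≤ 1 + s * z ^ 2 * Real.exp (s * z ^ 2) := by
          nlinarith [mul_le_mul_of_nonneg_left h2 (Real.exp_pos (s * z ^ 2)).le]
        have h5 : Real.exp (s * z ^ 2) ≤ Real.exp (K / 2 * z ^ 2) := by
          rw [Real.exp_le_exp]; gcongr
        calc Real.exp (s * z ^ 2) ≤ 1 + s * z ^ 2 * Real.exp (s * z ^ 2) := h4
          _ ≤ 1 + s * z ^ 2 * Real.exp (K / 2 * z ^ 2) := by gcongr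
          _ = _ := by ring
    _ = s * (∫ z, z ^ 2 * Real.exp (K / 2 * z ^ 2) ∂gaussianReal 0 v) + 1 := by
        rw [integral_add (integrable_const _) (hsq.const_mul s), integral_const_mul]
        simp [add_comm]
    _ ≤ _ := Real.add_one_le_exp _

end Gaussian

lemma continuous_kern_eval {ι : Type*} (τ : ℝ) (a : ι) : Continuous fun z : ι → ℝ => kern τ (z a) :=
  (continuous_kern τ).comp (continuous_apply a)

/-! ### Second moments of kernel sums under the product measure. -/

section Product

variable {ι : Type*} [Fintype ι] {v : ℝ≥0}

lemma integrable_prod_exp_sq {s : ℝ}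
    (he : Integrable (fun z => Real.exp (s * z ^ 2)) (gaussianReal 0 v)) (Q : Finset ι) :
    Integrable (fun z : ι → ℝ => ∏ q ∈ Q, Real.exp (s * z q ^ 2))
      (Measure.pi fun _ => gaussianReal 0 v) := by
  classical
  have h := Integrable.fintype_prod (μ := fun _ : ι => gaussianReal 0 v)
    (f := fun q u => if q ∈ Q then Real.exp (s * u ^ 2) else 1) (fun q => by
      by_cases hq : q ∈ Q
      · simpa [hq] using he
      · simp [hq])
  simpa [Finset.prod_ite_mem] using h

lemma integral_mul_prod_exp_sq {s : ℝ} {a : ι} {Q : Finset ι} (ha : a ∉ Q) (φ : ℝ → ℝ) :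
    ∫ z : ι → ℝ, φ (z a) * ∏ q ∈ Q, Real.exp (s * z q ^ 2) ∂Measure.pi (fun _ => gaussianReal 0 v) =
      (∫ u, φ u ∂gaussianReal 0 v) * (∫ u, Real.exp (s * u ^ 2) ∂gaussianReal 0 v) ^ Q.card := by
  classical
  -- The integrand is padded with factors 1 to a product over all coordinates, so that Fubini
  -- applies.
  have h := integral_fintype_prod_eq_prod (μ := fun _ : ι => gaussianReal 0 v) (𝕜 := ℝ)
    (fun q u => (if q = a then φ u else 1) * if q ∈ Q then Real.exp (s * u ^ 2) else 1)
  have hl : ∀ z : ι → ℝ, ∏ q, ((if q = a then φ (z q) else 1) *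
      if q ∈ Q then Real.exp (s * z q ^ 2) else 1) =
        φ (z a) * ∏ q ∈ Q, Real.exp (s * z q ^ 2) := by
    intro z
    rw [Finset.prod_mul_distrib, Finset.prod_ite_mem, Finset.prod_ite_eq' Finset.univ a]
    simp
  simp only [hl] at h
  rw [h]
  have hr : ∀ q, ∫ u, ((if q = a then φ u else 1) *
      if q ∈ Q then Real.exp (s * u ^ 2) else 1) ∂gaussianReal 0 v =
      (if q = a then ∫ u, φ u ∂gaussianReal 0 v else 1) *
        if q ∈ Q then ∫ u, Real.exp (s * u ^ 2) ∂gaussianReal 0 v else 1 := by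
    intro q
    by_cases hqa : q = a
    · have : q ∉ Q := hqa ▸ ha
      simp [hqa, ha]
    · by_cases hq : q ∈ Q <;> simp [hqa, hq]
  simp only [hr]
  rw [Finset.prod_mul_distrib, Finset.prod_ite_mem, Finset.prod_ite_eq' Finset.univ a]
  simp

/-- The tilt is even, so the factor at coordinate `a` is odd whether or not `a ∈ Q`, and its
integral vanishes. -/
lemma integral_odd_mul_odd_mul_prod {s : ℝ} {a b : ι} (hab : a ≠ b) (Q : Finset ι) {φ : ℝ → ℝ}
    (hφ : ∀ u, φ (-u) = -φ u) :
    ∫ z : ι → ℝ, φ (z a) * φ (z b) * ∏ q ∈ Q, Real.exp (s * z q ^ 2)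
      ∂Measure.pi (fun _ => gaussianReal 0 v) = 0 := by
  classical
  have h := integral_fintype_prod_eq_prod (μ := fun _ : ι => gaussianReal 0 v) (𝕜 := ℝ)
    (fun q u => (if q = a then φ u else 1) * (if q = b then φ u else 1) *
      if q ∈ Q then Real.exp (s * u ^ 2) else 1)
  have hl : ∀ z : ι → ℝ, ∏ q, ((if q = a then φ (z q) else 1) * (if q = b then φ (z q) else 1) *
      if q ∈ Q then Real.exp (s * z q ^ 2) else 1) =
        φ (z a) * φ (z b) * ∏ q ∈ Q, Real.exp (s * z q ^ 2) := by
    intro z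
    rw [Finset.prod_mul_distrib, Finset.prod_mul_distrib, Finset.prod_ite_mem,
      Finset.prod_ite_eq' Finset.univ a, Finset.prod_ite_eq' Finset.univ b]
    simp
  simp only [hl] at h
  rw [h]
  refine Finset.prod_eq_zero (Finset.mem_univ a) (integral_gaussianReal_of_odd fun u => ?_)
  by_cases ha : a ∈ Q <;> simp [hab, hφ, ha]

lemma integrable_kern_mul_kern_mul_prod {τ s : ℝ} (hτ : 0 < τ)
    (he : Integrable (fun z => Real.exp (s * z ^ 2)) (gaussianReal 0 v)) (Q : Finset ι) (a b : ι) :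
    Integrable (fun z : ι → ℝ => kern τ (z a) * kern τ (z b) * ∏ q ∈ Q, Real.exp (s * z q ^ 2))
      (Measure.pi fun _ => gaussianReal 0 v) := by
  refine ((integrable_prod_exp_sq he Q).const_mul (τ * τ)).mono' ?_
    (Filter.Eventually.of_forall fun z => ?_)
  · have h1 := continuous_kern_eval τ a
    have h2 := continuous_kern_eval τ b
    refine Continuous.aestronglyMeasurable ?_
    fun_prop
  · have : 0 ≤ ∏ q ∈ Q, Real.exp (s * z q ^ 2) := Finset.prod_nonneg fun q _ => (Real.exp_pos _).le
    rw [Real.norm_eq_abs, abs_mul, abs_mul, abs_of_nonneg this]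
    refine mul_le_mul_of_nonneg_right ?_ this
    exact mul_le_mul (abs_kern_le hτ _) (abs_kern_le hτ _) (abs_nonneg _) hτ.le

lemma integrable_kern_mul_kern {τ : ℝ} (hτ : 0 < τ) (a b : ι) :
    Integrable (fun z : ι → ℝ => kern τ (z a) * kern τ (z b))
      (Measure.pi fun _ => gaussianReal 0 v) := by
  have := integrable_kern_mul_kern_mul_prod (v := v) (s := 0) hτ (by simp) ∅ a b
  simpa using this

lemma sq_sum_mul_eq {κ : Type*} (D : Finset κ) (f : κ → ℝ) (r : ℝ) :
    (∑ d ∈ D, f d) ^ 2 * r = ∑ d ∈ D, ∑ d' ∈ D, f d * f d' * r := by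
  rw [sq, Finset.sum_mul_sum, Finset.sum_mul]
  simp_rw [Finset.sum_mul]

/-- The squared kernel carries `exp (-u²/τ²)`, which absorbs the tilt of its own coordinate. -/
lemma kern_sq_mul_exp_le {τ s : ℝ} (hs : s ≤ 1 / τ ^ 2) (u : ℝ) :
    kern τ u ^ 2 * Real.exp (s * u ^ 2) ≤ u ^ 2 := by
  have h1 : kern τ u ^ 2 * Real.exp (s * u ^ 2) =
      u ^ 2 * Real.exp ((s - 1 / τ ^ 2) * u ^ 2) := by
    have : (s - 1 / τ ^ 2) * u ^ 2 = ((2 : ℕ) : ℝ) * (-u ^ 2 / (2 * τ ^ 2)) + s * u ^ 2 := by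
      push_cast
      rcases eq_or_ne τ 0 with rfl | h
      · simp
      · field_simp; ring
    rw [this, Real.exp_add, Real.exp_nat_mul, kern]
    ring
  rw [h1]
  refine mul_le_of_le_one_right (sq_nonneg _) (Real.exp_le_one_iff.2 ?_)
  exact mul_nonpos_of_nonpos_of_nonneg (by linarith) (sq_nonneg _)

/-- Distinct coordinates contribute to the second moment only through the diagonal terms, even
after an exponential change of measure. -/
lemma integral_sq_sum_kern_mul_prod_le {τ s E : ℝ} (hτ : 0 < τ) (hs : s ≤ 1 / τ ^ 2)
    (he : Integrable (fun z => Real.exp (s * z ^ 2)) (gaussianReal 0 v))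
    (hE : ∫ z, Real.exp (s * z ^ 2) ∂gaussianReal 0 v ≤ E) (hE1 : 1 ≤ E) (Q : Finset ι) :
    Integrable (fun z : ι → ℝ => (∑ q ∈ Q, kern τ (z q)) ^ 2 * ∏ q ∈ Q, Real.exp (s * z q ^ 2))
        (Measure.pi fun _ => gaussianReal 0 v) ∧
      ∫ z : ι → ℝ, (∑ q ∈ Q, kern τ (z q)) ^ 2 * ∏ q ∈ Q, Real.exp (s * z q ^ 2)
        ∂Measure.pi (fun _ => gaussianReal 0 v) ≤ Q.card * (v * E ^ Q.card) := by
  classical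
  have hint := fun a b => integrable_kern_mul_kern_mul_prod hτ he Q a b
  simp only [sq_sum_mul_eq]
  refine ⟨integrable_finsetSum _ fun a _ => integrable_finsetSum _ fun b _ => hint a b, ?_⟩
  rw [integral_finsetSum _ fun a _ => integrable_finsetSum _ fun b _ => hint a b]
  rw [← nsmul_eq_mul]
  refine Finset.sum_le_card_nsmul _ _ _ fun a ha => ?_
  rw [integral_finsetSum _ fun b _ => hint a b, Finset.sum_eq_single_of_mem a ha
    fun b _ hb => integral_odd_mul_odd_mul_prod hb.symm Q (kern_neg τ)]
  have h1 : ∀ z : ι → ℝ, kern τ (z a) * kern τ (z a) * ∏ q ∈ Q, Real.exp (s * z q ^ 2) =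
      (kern τ (z a) ^ 2 * Real.exp (s * z a ^ 2)) * ∏ q ∈ Q.erase a, Real.exp (s * z q ^ 2) := by
    intro z
    rw [← Finset.mul_prod_erase Q _ ha]; ring
  simp only [h1]
  rw [integral_mul_prod_exp_sq (Finset.notMem_erase a Q)
    fun u => kern τ u ^ 2 * Real.exp (s * u ^ 2)]
  have h0 : 0 ≤ ∫ z, Real.exp (s * z ^ 2) ∂gaussianReal 0 v :=
    integral_nonneg fun z => (Real.exp_pos _).le
  refine mul_le_mul ?_ ?_ (pow_nonneg h0 _) v.2
  · rw [← integral_sq_gaussianReal (v := v)]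
    refine integral_mono_of_nonneg (Filter.Eventually.of_forall fun u => by positivity)
      integrable_sq_gaussianReal (Filter.Eventually.of_forall fun u => kern_sq_mul_exp_le hs u)
  · exact (pow_le_pow_left₀ h0 hE _).trans
      (pow_le_pow_right₀ hE1 (Finset.card_le_card (Finset.erase_subset _ _)))

lemma integrable_sq_sum_kern {κ : Type*} {τ : ℝ} (hτ : 0 < τ) (D : Finset κ) (π : κ → ι)
    (x : κ → ℝ) :
    Integrable (fun z : ι → ℝ => (∑ d ∈ D, kern τ (z (π d) + x d)) ^ 2)
        (Measure.pi fun _ => gaussianReal 0 v) := by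
  have hc : ∀ d, Continuous fun z : ι → ℝ => kern τ (z (π d) + x d) := fun d =>
    (continuous_kern τ).comp (by fun_prop)
  refine integrable_of_abs_le (K := (D.card * τ) ^ 2) (Continuous.aestronglyMeasurable
    ((continuous_finsetSum _ fun d _ => hc d).pow 2)) fun z => ?_
  rw [abs_pow]
  refine pow_le_pow_left₀ (abs_nonneg _) ((Finset.abs_sum_le_sum_abs _ _).trans ?_) 2
  rw [← nsmul_eq_mul]
  exact Finset.sum_le_card_nsmul _ _ _ fun d _ => abs_kern_le hτ _

/-- A sum of kernels of centred variables, with repetitions allowed, has at least the variance of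
the same number of independent terms. -/
lemma card_mul_le_integral_sq_sum_kern {κ : Type*} {τ : ℝ} (hτ : 0 < τ) (D : Finset κ)
    (π : κ → ι) :
    D.card * ∫ u, kern τ u ^ 2 ∂gaussianReal 0 v ≤
      ∫ z : ι → ℝ, (∑ d ∈ D, kern τ (z (π d))) ^ 2 ∂Measure.pi (fun _ => gaussianReal 0 v) := by
  classical
  have hint := fun a b => integrable_kern_mul_kern (v := v) (ι := ι) hτ a b
  have hd : ∀ a : ι, ∫ z : ι → ℝ, kern τ (z a) * kern τ (z a)
      ∂Measure.pi (fun _ => gaussianReal 0 v) = ∫ u, kern τ u ^ 2 ∂gaussianReal 0 v := by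
    intro a
    simp only [← sq]
    exact integral_comp_eval (μ := fun _ : ι => gaussianReal 0 v) (f := fun u => kern τ u ^ 2)
      ((continuous_kern τ).pow 2).aestronglyMeasurable
  -- A periodic window may wrap around and revisit a pixel. Repetitions only add nonnegative terms,
  -- while distinct pixels are uncorrelated.
  have hnn : ∀ a b : ι, 0 ≤ ∫ z : ι → ℝ, kern τ (z a) * kern τ (z b)
      ∂Measure.pi (fun _ => gaussianReal 0 v) := by
    intro a b
    rcases eq_or_ne a b with rfl | hab
    · exact integral_nonneg fun z => mul_self_nonneg _
    · have := integral_odd_mul_odd_mul_prod (v := v) (s := 0) hab ∅ (kern_neg τ)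
      simp only [Finset.prod_empty, mul_one] at this
      exact this.ge
  simp only [sq (Finset.sum _ _), Finset.sum_mul_sum]
  rw [integral_finsetSum _ fun a _ => integrable_finsetSum _ fun b _ => hint _ _,
    ← nsmul_eq_mul]
  refine Finset.card_nsmul_le_sum _ _ _ fun a ha => ?_
  rw [integral_finsetSum _ fun b _ => hint _ _, ← hd (π a)]
  exact Finset.single_le_sum (f := fun b => ∫ z : ι → ℝ, kern τ (z (π a)) * kern τ (z (π b))
      ∂Measure.pi (fun _ => gaussianReal 0 v)) (fun b _ => hnn _ _) ha

/-- The second moment of a sum of kernels is at least the square of its mean. -/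
lemma sq_mul_le_integral_sq_sum_kern {κ : Type*} {τ c : ℝ} (hτ : 0 < τ) (hc : 0 ≤ c)
    (hm : c ≤ ∫ u, kern τ (u + 1) ∂gaussianReal 0 v)
    (D D₁ : Finset κ) (hD : D₁ ⊆ D) (π : κ → ι) (x : κ → ℝ) (h1 : ∀ d ∈ D₁, x d = 1)
    (h0 : ∀ d ∈ D, d ∉ D₁ → x d = 0) :
    (D₁.card * c) ^ 2 ≤ ∫ z : ι → ℝ, (∑ d ∈ D, kern τ (z (π d) + x d)) ^ 2
        ∂Measure.pi (fun _ => gaussianReal 0 v) := by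
  classical
  have hcont : ∀ d, Continuous fun z : ι → ℝ => kern τ (z (π d) + x d) := fun d =>
    (continuous_kern τ).comp (by fun_prop)
  have hint : ∀ d, Integrable (fun z : ι → ℝ => kern τ (z (π d) + x d))
      (Measure.pi fun _ => gaussianReal 0 v) := fun d =>
    integrable_of_abs_le (hcont d).aestronglyMeasurable fun z => abs_kern_le hτ _
  have hE : ∀ d, ∫ z : ι → ℝ, kern τ (z (π d) + x d) ∂Measure.pi (fun _ => gaussianReal 0 v) =
      ∫ u, kern τ (u + x d) ∂gaussianReal 0 v := fun d =>
    integral_comp_eval (μ := fun _ : ι => gaussianReal 0 v) (f := fun u => kern τ (u + x d))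
      ((continuous_kern τ).comp (by fun_prop)).aestronglyMeasurable
  have hmean : D₁.card * c ≤ ∫ z : ι → ℝ, ∑ d ∈ D, kern τ (z (π d) + x d)
      ∂Measure.pi (fun _ => gaussianReal 0 v) := by
    -- Outside `D₁` the deviations are centred, so by oddness they contribute nothing to the mean.
    rw [integral_finsetSum _ fun d _ => hint d, ← Finset.sum_sdiff hD,
      Finset.sum_eq_zero (s := D \ D₁), zero_add, ← nsmul_eq_mul]
    · refine Finset.card_nsmul_le_sum _ _ _ fun d hd => ?_
      rw [hE, h1 d hd]; exact hm
    · intro d hd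
      rw [Finset.mem_sdiff] at hd
      rw [hE, h0 d hd.1 hd.2]
      simp only [add_zero]
      exact integral_gaussianReal_of_odd (kern_neg τ)
  refine (pow_le_pow_left₀ (by positivity) hmean 2).trans ?_
  have hsum : AEStronglyMeasurable (fun z : ι → ℝ => ∑ d ∈ D, kern τ (z (π d) + x d))
      (Measure.pi fun _ => gaussianReal 0 v) :=
    (continuous_finsetSum _ fun d _ => hcont d).aestronglyMeasurable
  have hvar := variance_nonneg (fun z : ι → ℝ => ∑ d ∈ D, kern τ (z (π d) + x d))
    (Measure.pi fun _ => gaussianReal 0 v)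
  rw [variance_eq_sub ((memLp_two_iff_integrable_sq hsum).2
    (integrable_sq_sum_kern hτ D π x))] at hvar
  simpa using hvar

end Product

/-! ### Deterministic bounds for the weighted mean. -/

section WeightedMean

variable {κ : Type*} {D : Finset κ} (τ : ℝ) (u : κ → ℝ)

lemma sum_weight_pos (hD : D.Nonempty) : 0 < ∑ d ∈ D, Real.exp (-u d ^ 2 / (2 * τ ^ 2)) :=
  Finset.sum_pos (fun _ _ => Real.exp_pos _) hD

lemma sum_weight_le_card : ∑ d ∈ D, Real.exp (-u d ^ 2 / (2 * τ ^ 2)) ≤ D.card := by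
  have := Finset.sum_le_card_nsmul D (fun d => Real.exp (-u d ^ 2 / (2 * τ ^ 2))) 1 fun d _ => by
    refine Real.exp_le_one_iff.2 (div_nonpos_of_nonpos_of_nonneg ?_ (by positivity))
    nlinarith [sq_nonneg (u d)]
  simpa using this

/-- Jensen's inequality for `exp`, proved with the tangent line at the mean exponent `m`. -/
lemma card_mul_exp_le_sum_weight (hD : D.Nonempty) :
    D.card * Real.exp (-(∑ d ∈ D, u d ^ 2) / (2 * τ ^ 2 * D.card)) ≤
      ∑ d ∈ D, Real.exp (-u d ^ 2 / (2 * τ ^ 2)) := by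
  have hN : (0 : ℝ) < D.card := by exact_mod_cast hD.card_pos
  set m := -(∑ d ∈ D, u d ^ 2) / (2 * τ ^ 2 * D.card) with hm
  have hpt : ∀ d ∈ D, Real.exp m * (-u d ^ 2 / (2 * τ ^ 2) - m + 1) ≤
      Real.exp (-u d ^ 2 / (2 * τ ^ 2)) := by
    intro d _
    have h := mul_le_mul_of_nonneg_left (Real.add_one_le_exp (-u d ^ 2 / (2 * τ ^ 2) - m))
      (Real.exp_pos m).le
    rwa [← Real.exp_add, add_sub_cancel] at h
  refine le_trans (le_of_eq ?_) (Finset.sum_le_sum hpt)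
  rw [← Finset.mul_sum, Finset.sum_add_distrib, Finset.sum_sub_distrib, ← Finset.sum_div,
    Finset.sum_neg_distrib]
  simp only [Finset.sum_const, nsmul_eq_mul, mul_one]
  have : -(∑ d ∈ D, u d ^ 2) / (2 * τ ^ 2) = D.card * m := by
    rw [hm, mul_div_assoc', mul_comm (2 * τ ^ 2) (D.card : ℝ), mul_div_mul_left _ _ hN.ne']
  rw [this]; ring

lemma sq_sum_kern_div_card_le (hD : D.Nonempty) :
    (∑ d ∈ D, kern τ (u d)) ^ 2 / (D.card : ℝ) ^ 2 ≤
      (∑ d ∈ D, kern τ (u d)) ^ 2 / (∑ d ∈ D, Real.exp (-u d ^ 2 / (2 * τ ^ 2))) ^ 2 := by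
  have h := sum_weight_pos τ u hD
  have h' := sum_weight_le_card (D := D) τ u
  gcongr

/-- The weights decrease with the deviation, so the weighted mean square is at most the plain
one. -/
lemma sq_sum_kern_div_le_mean_sq (hD : D.Nonempty) :
    (∑ d ∈ D, kern τ (u d)) ^ 2 / (∑ d ∈ D, Real.exp (-u d ^ 2 / (2 * τ ^ 2))) ^ 2 ≤
      (∑ d ∈ D, u d ^ 2) / D.card := by
  have hN : (0 : ℝ) < D.card := by exact_mod_cast hD.card_pos
  have hW := sum_weight_pos τ u hD
  set w : κ → ℝ := fun d => Real.exp (-u d ^ 2 / (2 * τ ^ 2)) with hw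
  -- Cauchy–Schwarz.
  have h1 : (∑ d ∈ D, kern τ (u d)) ^ 2 ≤ (∑ d ∈ D, w d) * ∑ d ∈ D, w d * u d ^ 2 := by
    refine Finset.sum_sq_le_sum_mul_sum_of_sq_le_mul D (fun d _ => (Real.exp_pos _).le)
      (fun d _ => mul_nonneg (Real.exp_pos _).le (sq_nonneg _)) fun d _ => ?_
    simp only [kern, hw]; exact le_of_eq (by ring)
  -- Chebyshev's sum inequality: weights and squared deviations are oppositely ordered.
  have h2 : D.card * ∑ d ∈ D, w d * u d ^ 2 ≤ (∑ d ∈ D, w d) * ∑ d ∈ D, u d ^ 2 := by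
    refine AntivaryOn.card_mul_sum_le_sum_mul_sum fun a _ b _ hab => ?_
    simp only [hw, Real.exp_le_exp]
    exact div_le_div_of_nonneg_right (neg_le_neg hab.le) (by positivity)
  rw [div_le_div_iff₀ (by positivity) hN]
  nlinarith [mul_le_mul_of_nonneg_left h2 hW.le, mul_le_mul_of_nonneg_right h1 hN.le]

/-- Jensen trades the random denominator for a factor that splits over the terms of the sum and is
even in each deviation. -/
lemma sq_sum_kern_div_le_mul_prod (hD : D.Nonempty) :
    (∑ d ∈ D, kern τ (u d)) ^ 2 / (∑ d ∈ D, Real.exp (-u d ^ 2 / (2 * τ ^ 2))) ^ 2 ≤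
      (1 / (D.card : ℝ) ^ 2) * ((∑ d ∈ D, kern τ (u d)) ^ 2 *
        ∏ d ∈ D, Real.exp (1 / (τ ^ 2 * D.card) * u d ^ 2)) := by
  have hN : (0 : ℝ) < D.card := by exact_mod_cast hD.card_pos
  have h := pow_le_pow_left₀ (by positivity) (card_mul_exp_le_sum_weight τ u hD) 2
  have hprod : ∏ d ∈ D, Real.exp (1 / (τ ^ 2 * D.card) * u d ^ 2) =
      (Real.exp (-(∑ d ∈ D, u d ^ 2) / (2 * τ ^ 2 * D.card)) ^ 2)⁻¹ := by
    rw [← Real.exp_sum, ← Finset.mul_sum, ← Real.exp_nat_mul, ← Real.exp_neg]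
    congr 1
    rcases eq_or_ne τ 0 with rfl | hτ
    · simp
    · push_cast; field_simp
  rw [hprod]
  calc _ ≤ (∑ d ∈ D, kern τ (u d)) ^ 2 /
        ((D.card : ℝ) * Real.exp (-(∑ d ∈ D, u d ^ 2) / (2 * τ ^ 2 * D.card))) ^ 2 := by
        gcongr
    _ = _ := by
        have := Real.exp_pos (-(∑ d ∈ D, u d ^ 2) / (2 * τ ^ 2 * D.card))
        rw [mul_pow]; field_simp

end WeightedMean

/-! ### From pixelwise errors to the risk. -/

section Estimator

variable {n : ℕ}

/-- The pixel at displacement `d` from `p`, with wrap-around. -/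
def neighbour (p : Fin n × Fin n) (d : ℤ × ℤ) : Fin n × Fin n := (shift p.1 d.1, shift p.2 d.2)

lemma shift_val_of_mem {i : Fin n} {d : ℤ} (h0 : 0 ≤ (i : ℤ) + d) (h1 : (i : ℤ) + d < n) :
    ((shift i d : Fin n) : ℤ) = i + d := by
  have h : (shift i d : ℕ) = (((i : ℤ) + d) % (n : ℤ)).toNat := rfl
  rw [h, Int.emod_eq_of_lt h0 h1, Int.toNat_of_nonneg h0]

lemma window_nonempty (b : Boundary) (Δ : ℕ) (p : Fin n × Fin n) : (window b Δ p).Nonempty := by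
  refine ⟨(0, 0), ?_⟩
  cases b <;> simp [window]

lemma semiOracleYF_error_sq (b : Boundary) (Δ : ℕ) (τ : ℝ) (x y : Fin n × Fin n → ℝ)
    (p : Fin n × Fin n) :
    (x p - semiOracleYF b Δ τ x y p) ^ 2 =
      (∑ d ∈ window b Δ p, kern τ (y (neighbour p d) - x p)) ^ 2 /
        (∑ d ∈ window b Δ p, Real.exp (-(y (neighbour p d) - x p) ^ 2 / (2 * τ ^ 2))) ^ 2 := by
  have hW := sum_weight_pos τ (fun d => y (neighbour p d) - x p) (window_nonempty b Δ p)
  have h : x p - semiOracleYF b Δ τ x y p =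
      -((∑ d ∈ window b Δ p, kern τ (y (neighbour p d) - x p)) /
        ∑ d ∈ window b Δ p, Real.exp (-(y (neighbour p d) - x p) ^ 2 / (2 * τ ^ 2))) := by
    have h1 : semiOracleYF b Δ τ x y p = (∑ d ∈ window b Δ p,
        Real.exp (-(y (neighbour p d) - x p) ^ 2 / (2 * τ ^ 2)) * y (neighbour p d)) /
        ∑ d ∈ window b Δ p, Real.exp (-(y (neighbour p d) - x p) ^ 2 / (2 * τ ^ 2)) := rfl
    simp only [kern, mul_sub, Finset.sum_sub_distrib, ← Finset.sum_mul]
    rw [h1, sub_div, mul_div_cancel_left₀ _ hW.ne', neg_sub]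
  rw [h, neg_sq, div_pow]

variable (σ : ℝ≥0) (f : ℝ × ℝ → ℝ) (est : (Fin n × Fin n → ℝ) → Fin n × Fin n → ℝ)

/-- Working with an integrable minorant `G` (and a majorant in `risk_le`) avoids any measurability
or integrability question for the estimator itself. -/
lemma le_risk (S : Finset (Fin n × Fin n)) (G : Fin n × Fin n → (Fin n × Fin n → ℝ) → ℝ) (c : ℝ)
    (hint : ∀ p ∈ S, Integrable (G p) (noise n σ)) (h0 : ∀ p ∈ S, ∀ z, 0 ≤ G p z)
    (hle : ∀ p ∈ S, ∀ z, G p z ≤ (pixelMean n f p - est (pixelMean n f + z) p) ^ 2)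
    (hc : ∀ p ∈ S, c ≤ ∫ z, G p z ∂noise n σ) :
    ENNReal.ofReal (1 / (n : ℝ) ^ 2 * (S.card * c)) ≤ risk n σ f est := by
  calc ENNReal.ofReal (1 / (n : ℝ) ^ 2 * (S.card * c))
      ≤ ENNReal.ofReal (∫ z, 1 / (n : ℝ) ^ 2 * ∑ p ∈ S, G p z ∂noise n σ) := by
        rw [integral_const_mul, integral_finsetSum _ hint, ← nsmul_eq_mul S.card]
        exact ENNReal.ofReal_le_ofReal (mul_le_mul_of_nonneg_left
          (Finset.card_nsmul_le_sum _ _ _ hc) (by positivity))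
    _ = ∫⁻ z, ENNReal.ofReal (1 / (n : ℝ) ^ 2 * ∑ p ∈ S, G p z) ∂noise n σ :=
        ofReal_integral_eq_lintegral_ofReal ((integrable_finsetSum _ hint).const_mul _)
          (Filter.Eventually.of_forall fun z =>
            mul_nonneg (by positivity) (Finset.sum_nonneg fun p hp => h0 p hp z))
    _ ≤ _ := by
        refine lintegral_mono fun z => ENNReal.ofReal_le_ofReal
          (mul_le_mul_of_nonneg_left ?_ (by positivity))
        exact (Finset.sum_le_sum fun p hp => hle p hp z).trans
          (Finset.sum_le_sum_of_subset_of_nonneg (Finset.subset_univ _) fun _ _ _ => sq_nonneg _)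

lemma risk_le (G : Fin n × Fin n → (Fin n × Fin n → ℝ) → ℝ) (c : Fin n × Fin n → ℝ)
    (hint : ∀ p, Integrable (G p) (noise n σ))
    (hle : ∀ p z, (pixelMean n f p - est (pixelMean n f + z) p) ^ 2 ≤ G p z)
    (hc : ∀ p, ∫ z, G p z ∂noise n σ ≤ c p) :
    risk n σ f est ≤ ENNReal.ofReal (1 / (n : ℝ) ^ 2 * ∑ p, c p) := by
  calc risk n σ f est
      ≤ ∫⁻ z, ENNReal.ofReal (1 / (n : ℝ) ^ 2 * ∑ p, G p z) ∂noise n σ :=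
        lintegral_mono fun z => ENNReal.ofReal_le_ofReal
          (mul_le_mul_of_nonneg_left (Finset.sum_le_sum fun p _ => hle p z) (by positivity))
    _ = ENNReal.ofReal (∫ z, 1 / (n : ℝ) ^ 2 * ∑ p, G p z ∂noise n σ) :=
        (ofReal_integral_eq_lintegral_ofReal
          ((integrable_finsetSum _ fun p _ => hint p).const_mul _)
          (Filter.Eventually.of_forall fun z => mul_nonneg (by positivity)
            (Finset.sum_nonneg fun p _ => (sq_nonneg _).trans (hle p z)))).symm
    _ ≤ _ := by
        rw [integral_const_mul, integral_finsetSum _ fun p _ => hint p]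
        exact ENNReal.ofReal_le_ofReal (mul_le_mul_of_nonneg_left
          (Finset.sum_le_sum fun p _ => hc p) (by positivity))

end Estimator

/-! ### Pixel averages of horizon images. -/

section Pixel

variable {n : ℕ}

lemma volume_pixel (p : Fin n × Fin n) :
    volume (pixel n p) ≠ 0 ∧ volume (pixel n p) ≠ ∞ := by
  have hn : (0 : ℝ) < n := by exact_mod_cast p.1.pos
  have h : ∀ a : ℝ, (a + 1) / n - a / n = 1 / n := fun a => by field_simp; ring
  have : volume (pixel n p) = ENNReal.ofReal (1 / n) * ENNReal.ofReal (1 / n) := by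
    rw [pixel, Measure.volume_eq_prod, Measure.prod_prod, Real.volume_Ico, Real.volume_Ico, h, h]
  rw [this]
  constructor
  · simp [hn]
  · finiteness

lemma measurableSet_pixel (p : Fin n × Fin n) : MeasurableSet (pixel n p) :=
  measurableSet_Ico.prod measurableSet_Ico

lemma pixelMean_eq_of_forall {f : ℝ × ℝ → ℝ} {p : Fin n × Fin n} {c : ℝ}
    (h : ∀ t ∈ pixel n p, f t = c) : pixelMean n f p = c := by
  rw [pixelMean, setAverage_congr_fun (measurableSet_pixel p)
    (Filter.Eventually.of_forall h), setAverage_const (volume_pixel p).1 (volume_pixel p).2]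

lemma pixelMean_mem_Icc (h : ℝ → ℝ) (p : Fin n × Fin n) :
    pixelMean n (horizonImage h) p ∈ Set.Icc (0 : ℝ) 1 := by
  have h0 : ∀ t, 0 ≤ horizonImage h t := fun t => Set.indicator_nonneg (fun _ _ => zero_le_one) t
  have h1 : ∀ t, horizonImage h t ≤ 1 := fun t =>
    Set.indicator_le_self' (fun _ _ => zero_le_one) t
  have hv := volume_pixel p
  have hpos : 0 < volume.real (pixel n p) := ENNReal.toReal_pos hv.1 hv.2
  rw [pixelMean, setAverage_eq, smul_eq_mul]
  refine ⟨mul_nonneg (by positivity) (integral_nonneg h0), ?_⟩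
  have hfin : IsFiniteMeasure (volume.restrict (pixel n p)) :=
    isFiniteMeasure_restrict.2 hv.2
  have hle : ∫ t in pixel n p, horizonImage h t ≤ ∫ _ in pixel n p, (1 : ℝ) :=
    integral_mono_of_nonneg (Filter.Eventually.of_forall h0) (integrable_const _)
      (Filter.Eventually.of_forall h1)
  rw [setIntegral_const, smul_eq_mul, mul_one] at hle
  rw [inv_mul_le_iff₀ hpos]
  linarith

lemma pixelMean_eq_zero {h : ℝ → ℝ} {p : Fin n × Fin n} (H : ∀ t ∈ pixel n p, h t.1 ≤ t.2) :
    pixelMean n (horizonImage h) p = 0 :=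
  pixelMean_eq_of_forall fun t ht => Set.indicator_of_notMem (by simpa using H t ht) _

lemma pixelMean_eq_one {h : ℝ → ℝ} {p : Fin n × Fin n} (H : ∀ t ∈ pixel n p, t.2 < h t.1) :
    pixelMean n (horizonImage h) p = 1 :=
  pixelMean_eq_of_forall fun t ht => Set.indicator_of_mem (by simpa using H t ht) _

lemma pixelMean_const_neg_one (p : Fin n × Fin n) :
    pixelMean n (horizonImage fun _ => -1) p = 0 := by
  refine pixelMean_eq_zero fun t ht => ?_
  have h1 : ((p.2 : ℕ) : ℝ) / n ≤ t.2 := ht.2.1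
  have h2 : (0 : ℝ) ≤ ((p.2 : ℕ) : ℝ) / n := by positivity
  linarith

/-- The edge is aligned with the grid, so no pixel is partially covered. -/
lemma pixelMean_const_div (J : ℕ) (p : Fin n × Fin n) :
    pixelMean n (horizonImage fun _ => (J : ℝ) / n) p = if (p.2 : ℕ) < J then 1 else 0 := by
  have hn : (0 : ℝ) < n := by exact_mod_cast p.1.pos
  split_ifs with hp
  · refine pixelMean_eq_one fun t ht => lt_of_lt_of_le ht.2.2 ?_
    have : ((p.2 : ℕ) : ℝ) + 1 ≤ J := by exact_mod_cast hp
    gcongr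
  · refine pixelMean_eq_zero fun t ht => le_trans ?_ ht.2.1
    have : (J : ℝ) ≤ ((p.2 : ℕ) : ℝ) := by exact_mod_cast not_lt.1 hp
    gcongr

end Pixel

lemma isHolder_const (ip : IntegerPart) {α C : ℝ} (hC : 0 ≤ C) (c : ℝ) :
    IsHolder ip α C fun _ => c := by
  refine ⟨fun m _ => ?_, fun t t' => ?_⟩
  · have : iteratedDeriv m (fun _ : ℝ => c) = fun _ => if m = 0 then c else 0 := by
      ext t; simp [iteratedDeriv_const]
    rw [this]; exact differentiable_const _
  · simp only [iteratedDeriv_const, sub_self, abs_zero]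
    positivity

/-- Both test images of the lower bound have constant horizons, so that bound does not depend on `α`
or `C`. -/
lemma horizonImage_const_mem (ip : IntegerPart) (α : ℝ) {C : ℝ} (hC : 0 ≤ C) (c : ℝ) :
    horizonImage (fun _ => c) ∈ horizonClass ip α C :=
  ⟨_, isHolder_const ip hC c, isHolder_const ip zero_le_one c, rfl⟩

/-! ### Window sizes, and the share of a window below an edge. -/

section Rows

variable {n : ℕ}

/-- The one-dimensional version of `window`. -/
noncomputable def rows (b : Boundary) (Δ : ℕ) (i : Fin n) : Finset ℤ :=
  match b with
  | .periodic => Finset.Icc (-(Δ : ℤ)) Δ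
  | .truncated => (Finset.Icc (-(Δ : ℤ)) Δ).filter fun d => 0 ≤ (i : ℤ) + d ∧ (i : ℤ) + d < n

lemma window_eq_product (b : Boundary) (Δ : ℕ) (p : Fin n × Fin n) :
    window b Δ p = rows b Δ p.1 ×ˢ rows b Δ p.2 := by
  ext d
  cases b
  · simp [window, rows]
  · simp [window, rows]; tauto

lemma card_rows_le (b : Boundary) (Δ : ℕ) (i : Fin n) : (rows b Δ i).card ≤ 2 * Δ + 1 := by
  have h : (Finset.Icc (-(Δ : ℤ)) Δ).card = 2 * Δ + 1 := by
    rw [Int.card_Icc]; omega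
  cases b
  · exact h.le
  · exact (Finset.card_filter_le _ _).trans h.le

lemma card_rows_truncated_le (Δ : ℕ) (i : Fin n) : (rows .truncated Δ i).card ≤ n := by
  have hsub : rows .truncated Δ i ⊆ Finset.Ico (-(i : ℤ)) (n - i) := by
    intro d hd
    simp only [rows, Finset.mem_filter] at hd
    rw [Finset.mem_Ico]
    omega
  refine (Finset.card_le_card hsub).trans ?_
  rw [Int.card_Ico]; omega

lemma card_window_le (b : Boundary) (Δ : ℕ) (p : Fin n × Fin n) :
    (window b Δ p).card ≤ (2 * Δ + 1) ^ 2 := by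
  rw [window_eq_product, Finset.card_product, sq]
  exact Nat.mul_le_mul (card_rows_le _ _ _) (card_rows_le _ _ _)

lemma mem_rows_of_mem {b : Boundary} {Δ : ℕ} {i : Fin n} {d : ℤ} (h : -(Δ : ℤ) ≤ d) (h' : d ≤ Δ)
    (h0 : 0 ≤ (i : ℤ) + d) (h1 : (i : ℤ) + d < n) : d ∈ rows b Δ i := by
  cases b <;> simp [rows, *]

/-- A row just above the level `J` sees the rows below this level in a positive proportion of its
neighbourhood. -/
lemma card_rows_le_mul_card_filter (b : Boundary) {Δ J : ℕ} (hΔ : 1 ≤ Δ) (hJ : n ≤ 3 * J)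
    (j : Fin n) (hj : J ≤ j) (hjΔ : 2 * (j - J) ≤ Δ) :
    (rows b Δ j).card ≤ 9 * ((rows b Δ j).filter fun d => (shift j d : ℕ) < J).card := by
  have hjn := j.2
  have hsub : Finset.Ico (max (-(j : ℤ)) (-Δ)) (J - j) ⊆
      (rows b Δ j).filter fun d => (shift j d : ℕ) < J := by
    intro d hd
    rw [Finset.mem_Ico, max_le_iff] at hd
    have hs := shift_val_of_mem (i := j) (d := d) (by omega) (by omega)
    refine Finset.mem_filter.2 ⟨mem_rows_of_mem (by omega) (by omega) (by omega) (by omega), ?_⟩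
    omega
  have hcard := Finset.card_le_card hsub
  rw [Int.card_Ico] at hcard
  have h2 := card_rows_le b Δ j
  -- Here the window is not much larger than the image, and the rows reached without wrap-around
  -- suffice. In the remaining periodic case with `n ≤ Δ`, they are counted over `Δ / n + 1`
  -- periods.
  by_cases hcase : b = .truncated ∨ Δ < n
  · have h3 : (rows b Δ j).card ≤ 2 * n := by
      rcases hcase with rfl | h
      · have := card_rows_truncated_le Δ j
        omega
      · omega
    omega
  · push Not at hcase
    obtain ⟨hb, hn⟩ := hcase
    obtain rfl : b = .periodic := by cases b <;> simp_all
    have hmul : J * (Δ / n + 1) ≤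
        ((rows .periodic Δ j).filter fun d => (shift j d : ℕ) < J).card := by
      have hinj : Set.InjOn (fun a : ℕ × ℕ => ((a.1 * n + a.2 : ℕ) : ℤ) - j)
          (Finset.range (Δ / n + 1) ×ˢ Finset.range J : Finset (ℕ × ℕ)) := by
        rintro ⟨k, r⟩ ha ⟨k', r'⟩ ha' h
        simp only [Finset.coe_product, Set.mem_prod, Finset.coe_range, Set.mem_Iio] at ha ha'
        have h : k * n + r = k' * n + r' := by
          have : ((k * n + r : ℕ) : ℤ) = ((k' * n + r' : ℕ) : ℤ) := by simpa using h
          exact_mod_cast this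
        have hr : r < n := by omega
        have hr' : r' < n := by omega
        have e1 : r = r' := by
          have := congrArg (· % n) h
          simpa [Nat.mul_add_mod_self_right, Nat.mod_eq_of_lt hr, Nat.mod_eq_of_lt hr'] using this
        subst e1
        have e2 : k = k' := Nat.eq_of_mul_eq_mul_right (by omega) (Nat.add_right_cancel h)
        rw [e2]
      have hmaps : ∀ a ∈ (Finset.range (Δ / n + 1) ×ˢ Finset.range J : Finset (ℕ × ℕ)),
          ((a.1 * n + a.2 : ℕ) : ℤ) - j ∈
            (rows .periodic Δ j).filter fun d => (shift j d : ℕ) < J := by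
        rintro ⟨k, r⟩ ha
        rw [Finset.mem_product, Finset.mem_range, Finset.mem_range] at ha
        simp only at ha ⊢
        have hk : k * n ≤ Δ :=
          (Nat.mul_le_mul_right n (Nat.lt_succ_iff.1 ha.1)).trans (Nat.div_mul_le_self Δ n)
        rw [Finset.mem_filter]
        constructor
        · simp only [rows, Finset.mem_Icc]
          omega
        · have : (shift j (((k * n + r : ℕ) : ℤ) - j) : ℕ) =
              (((j : ℤ) + (((k * n + r : ℕ) : ℤ) - j)) % (n : ℤ)).toNat := rfl
          rw [this, add_sub_cancel]
          have h3 : (((k * n + r : ℕ) : ℤ) % (n : ℤ)) = r := by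
            rw [← Int.natCast_mod, Nat.mul_add_mod_self_right, Nat.mod_eq_of_lt (by omega)]
          rw [h3]
          simpa using ha.2
      have := Finset.card_le_card_of_injOn _ hmaps hinj
      rwa [Finset.card_product, Finset.card_range, Finset.card_range, mul_comm] at this
    have h4 : Δ < n * (Δ / n + 1) := Nat.lt_mul_div_succ Δ (by omega)
    have h5 : n * (Δ / n + 1) ≤ 3 * (J * (Δ / n + 1)) := by
      rw [← mul_assoc]; exact Nat.mul_le_mul_right _ hJ
    omega

end Rows

/-! ### Variance and bias lower bounds. -/

section LowerBounds

variable {n : ℕ} {σ : ℝ≥0}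

lemma integrable_sq_sum_kern_div {κ : Type*} {τ : ℝ} (hτ : 0 < τ) (D : Finset κ)
    (π : κ → Fin n × Fin n) (x : κ → ℝ) (N : ℝ) :
    Integrable (fun z => (∑ d ∈ D, kern τ (z (π d) + x d)) ^ 2 / N) (noise n σ) :=
  (integrable_sq_sum_kern hτ D π x).div_const N

/-- The variance part of the lower bound, at the empty image. -/
lemma le_risk_empty_image (b : Boundary) (Δ : ℕ) {τ c : ℝ} (hn : 0 < n) (hτ : 0 < τ) (hc : 0 ≤ c)
    (hm : c ≤ ∫ u, kern τ u ^ 2 ∂gaussianReal 0 (σ ^ 2)) :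
    ENNReal.ofReal (c / (2 * Δ + 1) ^ 2) ≤ risk n σ (horizonImage fun _ => -1)
      (semiOracleYF b Δ τ (pixelMean n (horizonImage fun _ => -1))) := by
  set f := horizonImage fun _ => -1
  have hx : ∀ p, pixelMean n f p = 0 := pixelMean_const_neg_one
  have hn' : (0 : ℝ) < n := by exact_mod_cast hn
  have h := le_risk σ f (semiOracleYF b Δ τ (pixelMean n f)) Finset.univ
    (fun p z => (∑ d ∈ window b Δ p, kern τ (z (neighbour p d) + 0)) ^ 2 /
      ((window b Δ p).card : ℝ) ^ 2) (c / (2 * Δ + 1) ^ 2)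
    (fun p _ => integrable_sq_sum_kern_div hτ _ _ _ _) (fun p _ z => by positivity)
    (fun p _ z => by
      rw [semiOracleYF_error_sq]
      refine le_trans (le_of_eq ?_) (sq_sum_kern_div_card_le τ _ (window_nonempty b Δ p))
      simp [hx])
    (fun p _ => by
      have hN : (0 : ℝ) < (window b Δ p).card := by
        exact_mod_cast (window_nonempty b Δ p).card_pos
      have hN' : ((window b Δ p).card : ℝ) ≤ (2 * Δ + 1) ^ 2 := by
        exact_mod_cast card_window_le b Δ p
      have h1 := card_mul_le_integral_sq_sum_kern (v := σ ^ 2) hτ (window b Δ p) (neighbour p)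
      simp only [add_zero]
      rw [integral_div, le_div_iff₀ (by positivity)]
      refine le_trans ?_ (le_trans (mul_le_mul_of_nonneg_left hm hN.le) h1)
      rw [div_mul_eq_mul_div, div_le_iff₀ (by positivity)]
      nlinarith [mul_le_mul_of_nonneg_left hN' (mul_nonneg hc hN.le)])
  refine le_trans (le_of_eq ?_) h
  congr 1
  simp only [Finset.card_univ, Fintype.card_prod, Fintype.card_fin]
  push_cast
  field_simp

/-- The bias part of the lower bound, at an image with a horizontal edge. -/
lemma le_risk_horizontal_edge (b : Boundary) {Δ J D : ℕ} {τ c : ℝ} (hτ : 0 < τ) (hc : 0 ≤ c)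
    (hm : c ≤ ∫ u, kern τ (u + 1) ∂gaussianReal 0 (σ ^ 2))
    (hΔ : 1 ≤ Δ) (hJ : n ≤ 3 * J) (hDΔ : 2 * (D - 1) ≤ Δ) (hD : J + D ≤ n) :
    ENNReal.ofReal (D * (c / 9) ^ 2 / n) ≤ risk n σ (horizonImage fun _ => (J : ℝ) / n)
      (semiOracleYF b Δ τ (pixelMean n (horizonImage fun _ => (J : ℝ) / n))) := by
  classical
  set f := horizonImage fun _ => (J : ℝ) / n
  have hx : ∀ p, pixelMean n f p = if (p.2 : ℕ) < J then 1 else 0 := pixelMean_const_div J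
  -- The `D` rows just above the edge: the true value is 0 there, but ones fill a fixed share of the
  -- window.
  set S : Finset (Fin n × Fin n) :=
    Finset.univ ×ˢ Finset.univ.filter fun j : Fin n => J ≤ j ∧ (j : ℕ) < J + D with hS
  have hScard : S.card = n * D := by
    rw [hS, Finset.card_product, Finset.card_univ, Fintype.card_fin]
    congr 1
    have : (Finset.univ.filter fun j : Fin n => J ≤ j ∧ (j : ℕ) < J + D).map Fin.valEmbedding =
        Finset.Ico J (J + D) := by
      ext a
      simp only [Finset.mem_map, Finset.mem_filter, Finset.mem_univ, true_and,
        Fin.valEmbedding_apply, Finset.mem_Ico]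
      constructor
      · rintro ⟨j, hj, rfl⟩; exact hj
      · intro ha; exact ⟨⟨a, by omega⟩, ha, rfl⟩
    rw [← Finset.card_map Fin.valEmbedding, this, Nat.card_Ico]; omega
  have hSx : ∀ p ∈ S, J ≤ p.2 ∧ (p.2 : ℕ) < J + D := fun p hp => by
    simpa [hS] using hp
  have h := le_risk σ f (semiOracleYF b Δ τ (pixelMean n f)) S
    (fun p z => (∑ d ∈ window b Δ p,
      kern τ (z (neighbour p d) + pixelMean n f (neighbour p d))) ^ 2 /
      ((window b Δ p).card : ℝ) ^ 2) ((c / 9) ^ 2)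
    (fun p _ => integrable_sq_sum_kern_div hτ _ _ _ _) (fun p _ z => by positivity)
    (fun p hp z => by
      rw [semiOracleYF_error_sq]
      refine le_trans (le_of_eq ?_) (sq_sum_kern_div_card_le τ _ (window_nonempty b Δ p))
      have : pixelMean n f p = 0 := by rw [hx, if_neg (not_lt.2 (hSx p hp).1)]
      simp [this, add_comm])
    (fun p hp => by
      have hp' := hSx p hp
      have hN : (0 : ℝ) < (window b Δ p).card := by
        exact_mod_cast (window_nonempty b Δ p).card_pos
      set D₁ := rows b Δ p.1 ×ˢ (rows b Δ p.2).filter fun d => (shift p.2 d : ℕ) < J with hD₁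
      have hsub : D₁ ⊆ window b Δ p := by
        rw [window_eq_product]
        exact Finset.product_subset_product le_rfl (Finset.filter_subset _ _)
      have h1 := sq_mul_le_integral_sq_sum_kern (v := σ ^ 2) hτ hc hm (window b Δ p) D₁ hsub
        (neighbour p) (fun d => pixelMean n f (neighbour p d))
        (fun d hd => by
          rw [hD₁, Finset.mem_product, Finset.mem_filter] at hd
          rw [hx, if_pos (by exact hd.2.2)])
        (fun d hd hd' => by
          rw [window_eq_product, Finset.mem_product] at hd
          rw [hD₁, Finset.mem_product, Finset.mem_filter] at hd'
          rw [hx, if_neg]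
          intro hlt
          exact hd' ⟨hd.1, hd.2, hlt⟩)
      have h2 : ((window b Δ p).card : ℝ) ≤ 9 * D₁.card := by
        have := card_rows_le_mul_card_filter b hΔ hJ p.2 hp'.1 (by omega)
        have h3 : (window b Δ p).card ≤ 9 * D₁.card := by
          rw [window_eq_product, hD₁, Finset.card_product, Finset.card_product]
          calc _ ≤ (rows b Δ p.1).card * _ := Nat.mul_le_mul_left _ this
            _ = _ := by ring
        exact_mod_cast h3
      rw [integral_div, le_div_iff₀ (by positivity)]
      refine le_trans ?_ h1
      rw [← mul_pow]
      refine pow_le_pow_left₀ (by positivity) ?_ 2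
      nlinarith [mul_le_mul_of_nonneg_left h2 hc])
  refine le_trans (le_of_eq ?_) h
  congr 1
  rw [hScard]
  push_cast
  rcases Nat.eq_zero_or_pos n with rfl | hn
  · simp
  · have hn' : (0 : ℝ) < n := by exact_mod_cast hn
    field_simp

end LowerBounds

/-! ### Slopes of the horizon and the number of windows it crosses. -/

/-- A horizon of Hölder order `1` is, up to reflection, nowhere steeper than `-1`. -/
lemma IsHolder.monotone_add_or_antitone_sub {ip : IntegerPart} {h : ℝ → ℝ}
    (hh : IsHolder ip 1 1 h) : Monotone (fun t => h t + t) ∨ Antitone (fun t => h t - t) := by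
  obtain ⟨hd, hh⟩ := hh
  cases ip with
  | strict =>
    have e : IntegerPart.strict.eval 1 = 0 := by simp [IntegerPart.eval]
    rw [e] at hh
    left
    intro a b hab
    have h1 := hh a b
    simp only [iteratedDeriv_zero, Nat.cast_zero, sub_zero, Real.rpow_one, one_mul] at h1
    rw [abs_of_nonpos (sub_nonpos.2 hab)] at h1
    have := (abs_le.1 h1).2
    simp only
    linarith
  -- In this reading only the oscillation of the derivative is bounded by 1; the slope itself can be
  -- arbitrarily steep.
  | floor =>
    have e : IntegerPart.floor.eval 1 = 1 := by simp [IntegerPart.eval]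
    rw [e] at hh hd
    have hdiff : Differentiable ℝ h := by simpa using hd 0 (by norm_num)
    have hosc : ∀ t t', deriv h t - deriv h t' ≤ 1 := by
      intro t t'
      have := hh t t'
      simp only [iteratedDeriv_one, Nat.cast_one, sub_self, Real.rpow_zero, mul_one] at this
      exact (abs_le.1 this).2
    by_cases hcase : ∀ t, -1 ≤ deriv h t
    · left
      refine monotone_of_deriv_nonneg (hdiff.add differentiable_id) fun t => ?_
      rw [deriv_fun_add (hdiff t) differentiableAt_fun_id, deriv_id'']
      linarith [hcase t]
    -- One slope below `-1` forces all slopes to be negative.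
    · right
      push Not at hcase
      obtain ⟨t₀, ht₀⟩ := hcase
      refine antitone_of_deriv_nonpos (hdiff.sub differentiable_id) fun t => ?_
      rw [deriv_fun_sub (hdiff t) differentiableAt_fun_id, deriv_id'']
      linarith [hosc t t₀]

section Geometry

variable {n : ℕ}

/-- The region of the plane covered by the `Δ`-neighbourhood of the pixel `p`. -/
def block (Δ : ℕ) (p : Fin n × Fin n) : Set (ℝ × ℝ) :=
  Set.Ico ((((p.1 : ℕ) : ℝ) - Δ) / n) ((((p.1 : ℕ) : ℝ) + Δ + 1) / n) ×ˢ
    Set.Ico ((((p.2 : ℕ) : ℝ) - Δ) / n) ((((p.2 : ℕ) : ℝ) + Δ + 1) / n)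

lemma mem_block_iff {Δ : ℕ} {p : Fin n × Fin n} {t : ℝ × ℝ} :
    t ∈ block Δ p ↔ (((p.1 : ℕ) : ℝ) - Δ ≤ t.1 * n ∧ t.1 * n < ((p.1 : ℕ) : ℝ) + Δ + 1) ∧
      ((p.2 : ℕ) : ℝ) - Δ ≤ t.2 * n ∧ t.2 * n < ((p.2 : ℕ) : ℝ) + Δ + 1 := by
  have hn : (0 : ℝ) < n := by exact_mod_cast p.1.pos
  simp only [block, Set.mem_prod, Set.mem_Ico, div_le_iff₀ hn, lt_div_iff₀ hn]

/-- The horizon crosses the `Δ`-neighbourhood of `p`. -/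
def Crosses (h : ℝ → ℝ) (Δ : ℕ) (p : Fin n × Fin n) : Prop :=
  (∃ t ∈ block Δ p, t.2 < h t.1) ∧ ∃ t ∈ block Δ p, h t.1 ≤ t.2

/-- The `Δ`-neighbourhood of `p` does not leave the image. -/
def Interior (Δ : ℕ) (p : Fin n × Fin n) : Prop :=
  (Δ ≤ p.1 ∧ (p.1 : ℕ) + Δ < n) ∧ Δ ≤ p.2 ∧ (p.2 : ℕ) + Δ < n

/-- A fibre of `key` meets each column at most once, and its points in `S` lie in `L` consecutive
columns. -/
lemma card_le_of_key {S : Finset (Fin n × Fin n)} (key : Fin n × Fin n → ℕ) {K L : ℕ}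
    (hkey : ∀ p, key p < K) (hinj : ∀ p q, key p = key q → p.1 = q.1 → p = q)
    (hS : ∀ p ∈ S, ∀ q ∈ S, key p = key q → p.1 ≤ q.1 → (q.1 : ℕ) < p.1 + L) :
    S.card ≤ L * K := by
  classical
  have himg : (S.image key).card ≤ K := by
    refine (Finset.card_le_card (t := Finset.range K) fun a ha => ?_).trans
      (Finset.card_range K).le
    obtain ⟨p, _, rfl⟩ := Finset.mem_image.1 ha
    exact Finset.mem_range.2 (hkey p)
  refine (Finset.card_le_mul_card_image S L fun a _ => ?_).trans (Nat.mul_le_mul_left L himg)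
  rcases (S.filter fun p => key p = a).eq_empty_or_nonempty with he | hne
  · simp [he]
  · obtain ⟨p, hp, hmin⟩ := Finset.exists_min_image _ (fun p => p.1) hne
    rw [Finset.mem_filter] at hp
    have := Finset.card_le_card_of_injOn (s := S.filter fun p => key p = a)
      (t := Finset.Ico (p.1 : ℕ) (p.1 + L)) (fun q => (q.1 : ℕ))
      (fun q hq => by
        have hq' := Finset.mem_filter.1 hq
        exact Finset.mem_coe.2 (Finset.mem_Ico.2
          ⟨hmin q hq, hS p hp.1 q hq'.1 (hp.2.trans hq'.2.symm) (hmin q hq)⟩))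
      (fun q hq r hr hqr => by
        have hq' := (Finset.mem_filter.1 (Finset.mem_coe.1 hq)).2
        have hr' := (Finset.mem_filter.1 (Finset.mem_coe.1 hr)).2
        exact hinj q r (hq'.trans hr'.symm) (Fin.ext hqr))
    simpa using this

lemma fst_le_of_mem_block {Δ : ℕ} {p q : Fin n × Fin n} {s t : ℝ × ℝ} (hs : s ∈ block Δ p)
    (ht : t ∈ block Δ q) (h : (p.1 : ℕ) + (4 * Δ + 2) ≤ q.1) : s.1 ≤ t.1 := by
  have hn : (0 : ℝ) < n := by exact_mod_cast p.1.pos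
  have h' : (((p.1 : ℕ) : ℝ) + (4 * Δ + 2)) ≤ ((q.1 : ℕ) : ℝ) := by exact_mod_cast h
  rw [mem_block_iff] at hs ht
  refine le_of_mul_le_mul_right ?_ hn
  have : (0 : ℝ) ≤ Δ := by positivity
  linarith [hs.1.2, ht.1.1]

/-- Few neighbourhoods are crossed by the horizon: along the lines of slope `∓2` it is crossed
at most once. -/
lemma card_crosses_le {ip : IntegerPart} {h : ℝ → ℝ} (hh : IsHolder ip 1 1 h) (Δ : ℕ)
    (S : Finset (Fin n × Fin n)) (hS : ∀ p ∈ S, Crosses h Δ p) :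
    S.card ≤ (4 * Δ + 2) * (3 * n) := by
  rcases hh.monotone_add_or_antitone_sub with hm | hm
  -- The level sets are lines of slope `-2`. Moving `4Δ + 2` columns along one lowers the sum of the
  -- pixel coordinates by `4Δ + 2`, which exactly exhausts the variation `2Δ + (2Δ + 2)` of `n (t.1
  -- + t.2)` within the two blocks. Yet monotonicity of `h t + t` would force this sum to increase
  -- from `s` to `t`.
  · refine card_le_of_key (fun p => p.2 + 2 * p.1) (fun p => by have := p.1.2; have := p.2.2; omega)
      (fun p q h1 h2 => Prod.ext h2 (Fin.ext (by rw [h2] at h1; omega))) ?_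
    intro p hp q hq hkey _
    by_contra! hlt
    have hn : (0 : ℝ) < n := by exact_mod_cast p.1.pos
    obtain ⟨⟨s, hs, hs1⟩, -⟩ := hS p hp
    obtain ⟨-, ⟨t, ht, ht0⟩⟩ := hS q hq
    have hst := fst_le_of_mem_block hs ht hlt
    have hmono : h s.1 + s.1 ≤ h t.1 + t.1 := hm hst
    have hlt' : (((p.1 : ℕ) : ℝ) + (4 * Δ + 2)) ≤ ((q.1 : ℕ) : ℝ) := by exact_mod_cast hlt
    have hkey' : ((p.2 : ℕ) : ℝ) + 2 * ((p.1 : ℕ) : ℝ) =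
      ((q.2 : ℕ) : ℝ) + 2 * ((q.1 : ℕ) : ℝ) := by exact_mod_cast hkey
    rw [mem_block_iff] at hs ht
    have hmul : (s.1 + s.2) * n < (t.1 + t.2) * n :=
      mul_lt_mul_of_pos_right (by linarith) hn
    linarith [hs.1.1, hs.2.1, ht.1.2, ht.2.2]
  -- The mirror image, with lines of slope `2`; reflecting the column keeps the key below `3n`.
  · refine card_le_of_key (fun p => p.2 + 2 * (n - 1 - p.1))
      (fun p => by have := p.1.2; have := p.2.2; omega)
      (fun p q h1 h2 => Prod.ext h2 (Fin.ext (by rw [h2] at h1; omega))) ?_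
    intro p hp q hq hkey _
    by_contra! hlt
    have hn : (0 : ℝ) < n := by exact_mod_cast p.1.pos
    obtain ⟨-, ⟨s, hs, hs0⟩⟩ := hS p hp
    obtain ⟨⟨t, ht, ht1⟩, -⟩ := hS q hq
    have hst := fst_le_of_mem_block hs ht hlt
    have hmono : h t.1 - t.1 ≤ h s.1 - s.1 := hm hst
    have hlt' : (((p.1 : ℕ) : ℝ) + (4 * Δ + 2)) ≤ ((q.1 : ℕ) : ℝ) := by exact_mod_cast hlt
    have hkey' : ((p.2 : ℕ) : ℝ) + 2 * ((q.1 : ℕ) : ℝ) =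
        ((q.2 : ℕ) : ℝ) + 2 * ((p.1 : ℕ) : ℝ) := by
      have hp2 := p.1.2
      have hq2 := q.1.2
      have : (p.2 : ℕ) + 2 * (q.1 : ℕ) = q.2 + 2 * p.1 := by
        omega
      exact_mod_cast this
    rw [mem_block_iff] at hs ht
    have hmul : (t.2 - t.1) * n < (s.2 - s.1) * n :=
      mul_lt_mul_of_pos_right (by linarith) hn
    linarith [hs.1.1, hs.2.2, ht.1.2, ht.2.1]

lemma card_near_boundary_le (Δ : ℕ) :
    (Finset.univ.filter fun i : Fin n => ¬(Δ ≤ i ∧ (i : ℕ) + Δ < n)).card ≤ 2 * Δ := by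
  have hmaps : (Finset.univ.filter fun i : Fin n => ¬(Δ ≤ i ∧ (i : ℕ) + Δ < n)).map
      Fin.valEmbedding ⊆ Finset.range Δ ∪ Finset.Ico (n - Δ) n := by
    intro a ha
    obtain ⟨i, hi, rfl⟩ := Finset.mem_map.1 ha
    have := i.2
    simp only [Finset.mem_filter, Finset.mem_univ, true_and] at hi
    simp only [Fin.valEmbedding_apply, Finset.mem_union, Finset.mem_range, Finset.mem_Ico]
    omega
  rw [← Finset.card_map Fin.valEmbedding]
  refine (Finset.card_le_card hmaps).trans ((Finset.card_union_le _ _).trans ?_)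
  rw [Finset.card_range, Nat.card_Ico]
  omega

lemma card_not_interior_le (Δ : ℕ) (S : Finset (Fin n × Fin n))
    (hS : ∀ p ∈ S, ¬Interior Δ p) : S.card ≤ 4 * Δ * n := by
  classical
  set A := Finset.univ.filter fun i : Fin n => ¬(Δ ≤ i ∧ (i : ℕ) + Δ < n) with hA
  have hsub : S ⊆ A ×ˢ Finset.univ ∪ Finset.univ ×ˢ A := by
    intro p hp
    have := hS p hp
    rw [Interior, not_and_or] at this
    rw [Finset.mem_union, Finset.mem_product, Finset.mem_product, hA]
    simpa only [Finset.mem_filter, Finset.mem_univ, true_and, and_true] using this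
  have hcard : A.card ≤ 2 * Δ := card_near_boundary_le Δ
  refine (Finset.card_le_card hsub).trans ((Finset.card_union_le _ _).trans ?_)
  rw [Finset.card_product, Finset.card_product, Finset.card_univ, Fintype.card_fin]
  nlinarith [Nat.mul_le_mul_right n hcard]

variable {b : Boundary} {Δ : ℕ} {p : Fin n × Fin n}

lemma rows_eq_Icc {i : Fin n} (h0 : Δ ≤ i) (h1 : (i : ℕ) + Δ < n) :
    rows b Δ i = Finset.Icc (-(Δ : ℤ)) Δ := by
  cases b
  · rfl
  · refine Finset.filter_true_of_mem fun d hd => ?_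
    rw [Finset.mem_Icc] at hd
    omega

lemma Interior.window_eq (hp : Interior Δ p) :
    window b Δ p = Finset.Icc (-(Δ : ℤ)) Δ ×ˢ Finset.Icc (-(Δ : ℤ)) Δ := by
  rw [window_eq_product, rows_eq_Icc hp.1.1 hp.1.2, rows_eq_Icc hp.2.1 hp.2.2]

lemma Interior.card_window (hp : Interior Δ p) : (window b Δ p).card = (2 * Δ + 1) ^ 2 := by
  rw [hp.window_eq, Finset.card_product, Int.card_Icc, sq]
  congr 1 <;> omega

lemma Interior.neighbour_val (hp : Interior Δ p) {d : ℤ × ℤ} (hd : d ∈ window b Δ p) :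
    ((neighbour p d).1 : ℤ) = p.1 + d.1 ∧ ((neighbour p d).2 : ℤ) = p.2 + d.2 := by
  rw [hp.window_eq, Finset.mem_product, Finset.mem_Icc, Finset.mem_Icc] at hd
  obtain ⟨⟨h1, h2⟩, h3, h4⟩ := hp
  exact ⟨shift_val_of_mem (by omega) (by omega), shift_val_of_mem (by omega) (by omega)⟩

/-- Without wrap-around the window sees distinct pixels, hence independent noise. -/
lemma Interior.injOn_neighbour (hp : Interior Δ p) :
    Set.InjOn (neighbour p) (window b Δ p) := by
  intro d hd e he hde
  have h1 := hp.neighbour_val hd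
  have h2 := hp.neighbour_val he
  rw [hde] at h1
  exact Prod.ext (by omega) (by omega)

lemma Interior.pixel_subset_block (hp : Interior Δ p) {d : ℤ × ℤ} (hd : d ∈ window b Δ p) :
    pixel n (neighbour p d) ⊆ block Δ p := by
  intro t ht
  have hn : (0 : ℝ) < n := by exact_mod_cast p.1.pos
  have hv := hp.neighbour_val hd
  rw [hp.window_eq, Finset.mem_product, Finset.mem_Icc, Finset.mem_Icc] at hd
  simp only [pixel, Set.mem_prod, Set.mem_Ico, div_le_iff₀ hn, lt_div_iff₀ hn] at ht
  have e1 : (((neighbour p d).1 : ℕ) : ℝ) = ((p.1 : ℕ) : ℝ) + (d.1 : ℝ) := by exact_mod_cast hv.1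
  have e2 : (((neighbour p d).2 : ℕ) : ℝ) = ((p.2 : ℕ) : ℝ) + (d.2 : ℝ) := by exact_mod_cast hv.2
  have b1 : -(Δ : ℝ) ≤ d.1 := by exact_mod_cast hd.1.1
  have b2 : (d.1 : ℝ) ≤ Δ := by exact_mod_cast hd.1.2
  have b3 : -(Δ : ℝ) ≤ d.2 := by exact_mod_cast hd.2.1
  have b4 : (d.2 : ℝ) ≤ Δ := by exact_mod_cast hd.2.2
  rw [e1, e2] at ht
  rw [mem_block_iff]
  refine ⟨⟨?_, ?_⟩, ?_, ?_⟩ <;> linarith [ht.1.1, ht.1.2, ht.2.1, ht.2.2]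

/-- The noise-free image is constant near an interior pixel whose neighbourhood the horizon does
not cross. -/
lemma Interior.pixelMean_neighbour {h : ℝ → ℝ} (hp : Interior Δ p) (hc : ¬Crosses h Δ p)
    {d : ℤ × ℤ} (hd : d ∈ window b Δ p) :
    pixelMean n (horizonImage h) (neighbour p d) = pixelMean n (horizonImage h) p := by
  have h0 : ((0, 0) : ℤ × ℤ) ∈ window b Δ p := by
    rw [hp.window_eq]; simp
  have hp0 : neighbour p (0, 0) = p := by
    have := hp.neighbour_val h0
    exact Prod.ext (Fin.ext (by simpa using this.1)) (Fin.ext (by simpa using this.2))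
  have hsub := fun e (he : e ∈ window b Δ p) => hp.pixel_subset_block he
  have hpp : pixel n p ⊆ block Δ p := by simpa only [hp0] using hsub _ h0
  rw [Crosses, not_and_or] at hc
  rcases hc with hc | hc
  · push Not at hc
    rw [pixelMean_eq_zero fun t ht => hc t (hsub d hd ht),
      pixelMean_eq_zero fun t ht => hc t (hpp ht)]
  · push Not at hc
    rw [pixelMean_eq_one fun t ht => hc t (hsub d hd ht),
      pixelMean_eq_one fun t ht => hc t (hpp ht)]

end Geometry

/-! ### The risk upper bound. -/

section UpperBound

variable {n : ℕ} {σ : ℝ≥0}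

/-- Only linearity of the expectation is used, so repeated neighbours under wrap-around do no harm.
-/
lemma integral_mean_sq_le {κ : Type*} {D : Finset κ} (hD : D.Nonempty) (π : κ → Fin n × Fin n)
    (a : κ → ℝ) (ha : ∀ d, |a d| ≤ 1) :
    Integrable (fun z : Fin n × Fin n → ℝ => (∑ d ∈ D, (z (π d) + a d) ^ 2) / D.card)
        (noise n σ) ∧
      ∫ z, (∑ d ∈ D, (z (π d) + a d) ^ 2) / D.card ∂noise n σ ≤ (σ : ℝ) ^ 2 + 1 := by
  have hN : (0 : ℝ) < D.card := by exact_mod_cast hD.card_pos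
  have hint1 : ∀ c : ℝ, Integrable (fun u : ℝ => (u + c) ^ 2) (gaussianReal 0 (σ ^ 2)) := by
    intro c
    refine ((integrable_sq_gaussianReal.add (integrable_id_gaussianReal.const_mul (2 * c))).add
      (integrable_const (c ^ 2))).congr (Filter.Eventually.of_forall fun u => ?_)
    simp only [Pi.add_apply]; ring
  have hval1 : ∀ c : ℝ, ∫ u, (u + c) ^ 2 ∂gaussianReal 0 (σ ^ 2) = (σ : ℝ) ^ 2 + c ^ 2 := by
    intro c
    have e : ∀ u : ℝ, (u + c) ^ 2 = u ^ 2 + 2 * c * u + c ^ 2 := fun u => by ring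
    simp only [e]
    have hi : Integrable (fun u : ℝ => u ^ 2 + 2 * c * u) (gaussianReal 0 (σ ^ 2)) :=
      integrable_sq_gaussianReal.add (integrable_id_gaussianReal.const_mul _)
    rw [integral_add hi (integrable_const _), integral_add integrable_sq_gaussianReal
      (integrable_id_gaussianReal.const_mul _), integral_const_mul, integral_id_gaussianReal,
      integral_sq_gaussianReal]
    simp
  have hint : ∀ d, Integrable (fun z : Fin n × Fin n → ℝ => (z (π d) + a d) ^ 2) (noise n σ) :=
    fun d => integrable_comp_eval (μ := fun _ : Fin n × Fin n => gaussianReal 0 (σ ^ 2))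
      (f := fun u => (u + a d) ^ 2) (hint1 (a d))
  refine ⟨(integrable_finsetSum _ fun d _ => hint d).div_const _, ?_⟩
  rw [integral_div, integral_finsetSum _ fun d _ => hint d, div_le_iff₀ hN, mul_comm,
    ← nsmul_eq_mul]
  refine Finset.sum_le_card_nsmul _ _ _ fun d _ => ?_
  have : ∫ z, (z (π d) + a d) ^ 2 ∂noise n σ = ∫ u, (u + a d) ^ 2 ∂gaussianReal 0 (σ ^ 2) :=
    integral_comp_eval (μ := fun _ : Fin n × Fin n => gaussianReal 0 (σ ^ 2))
      (f := fun u => (u + a d) ^ 2) (hint1 (a d)).aestronglyMeasurable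
  rw [this, hval1]
  have := (sq_le_one_iff_abs_le_one (a d)).2 (ha d)
  linarith

/-- The mean squared error at any pixel is bounded. -/
lemma exists_error_bound (b : Boundary) (Δ : ℕ) (τ : ℝ) (h : ℝ → ℝ) (p : Fin n × Fin n) :
    ∃ G : (Fin n × Fin n → ℝ) → ℝ, Integrable G (noise n σ) ∧
      (∀ z, (pixelMean n (horizonImage h) p - semiOracleYF b Δ τ (pixelMean n (horizonImage h))
        (pixelMean n (horizonImage h) + z) p) ^ 2 ≤ G z) ∧
      ∫ z, G z ∂noise n σ ≤ (σ : ℝ) ^ 2 + 1 := by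
  set x := pixelMean n (horizonImage h)
  have hx : ∀ q, x q ∈ Set.Icc (0 : ℝ) 1 := pixelMean_mem_Icc h
  have hb := integral_mean_sq_le (σ := σ) (window_nonempty b Δ p) (neighbour p)
    (fun d => x (neighbour p d) - x p) (fun d => by
      have h1 := hx (neighbour p d)
      have h2 := hx p
      rw [abs_le]
      constructor <;> linarith [h1.1, h1.2, h2.1, h2.2])
  refine ⟨_, hb.1, fun z => ?_, hb.2⟩
  rw [semiOracleYF_error_sq]
  refine (sq_sum_kern_div_le_mean_sq τ _ (window_nonempty b Δ p)).trans (le_of_eq ?_)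
  congr 1
  refine Finset.sum_congr rfl fun d _ => ?_
  simp only [Pi.add_apply]; ring

/-- The mean squared error where the noise-free image is constant is of the order of the inverse
size of the neighbourhood. -/
lemma exists_error_bound_of_not_crosses (b : Boundary) {Δ : ℕ} {τ s₀ B : ℝ} (hτ : 0 < τ)
    (hB : 0 ≤ B)
    (hexp : ∀ s, 0 ≤ s → s ≤ s₀ →
      Integrable (fun z => Real.exp (s * z ^ 2)) (gaussianReal 0 (σ ^ 2)) ∧
        ∫ z, Real.exp (s * z ^ 2) ∂gaussianReal 0 (σ ^ 2) ≤ Real.exp (s * B))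
    (hs₀ : 1 / (τ ^ 2 * (2 * Δ + 1) ^ 2) ≤ s₀) (h : ℝ → ℝ) {p : Fin n × Fin n}
    (hp : Interior Δ p) (hc : ¬Crosses h Δ p) :
    ∃ G : (Fin n × Fin n → ℝ) → ℝ, Integrable G (noise n σ) ∧
      (∀ z, (pixelMean n (horizonImage h) p - semiOracleYF b Δ τ (pixelMean n (horizonImage h))
        (pixelMean n (horizonImage h) + z) p) ^ 2 ≤ G z) ∧
      ∫ z, G z ∂noise n σ ≤ (σ : ℝ) ^ 2 * Real.exp (B / τ ^ 2) / (2 * Δ + 1) ^ 2 := by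
  classical
  set x := pixelMean n (horizonImage h)
  have hinj := hp.injOn_neighbour (b := b)
  set Q := (window b Δ p).image (neighbour p) with hQ
  have hQc : Q.card = (2 * Δ + 1) ^ 2 := by
    rw [hQ, Finset.card_image_of_injOn hinj, hp.card_window]
  -- The tilt produced by Jensen's inequality, with `N = (2Δ+1)²`; the `N` factors `exp (s * B)`
  -- multiply to `exp (B / τ²)`.
  set s : ℝ := 1 / (τ ^ 2 * (2 * Δ + 1) ^ 2) with hs
  have hN : (0 : ℝ) < (2 * Δ + 1) ^ 2 := by positivity
  have hs0 : 0 ≤ s := by positivity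
  have hs1 : s ≤ 1 / τ ^ 2 := by
    rw [hs]
    refine one_div_le_one_div_of_le (by positivity) (le_mul_of_one_le_right (by positivity) ?_)
    exact one_le_pow₀ (by linarith [(Nat.cast_nonneg Δ : (0 : ℝ) ≤ Δ)])
  obtain ⟨hi, hE⟩ := hexp s hs0 hs₀
  have hb := integral_sq_sum_kern_mul_prod_le hτ hs1 hi hE
    (Real.one_le_exp (mul_nonneg hs0 hB)) Q
  refine ⟨_, hb.1.const_mul (1 / ((2 * Δ + 1) ^ 2 : ℝ) ^ 2), fun z => ?_, ?_⟩
  · rw [semiOracleYF_error_sq]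
    refine (sq_sum_kern_div_le_mul_prod τ _ (window_nonempty b Δ p)).trans (le_of_eq ?_)
    rw [hQ, Finset.sum_image hinj, Finset.prod_image hinj, hp.card_window]
    have hz : ∀ d ∈ window b Δ p, (x + z) (neighbour p d) - x p = z (neighbour p d) := by
      intro d hd
      have : x (neighbour p d) = x p := hp.pixelMean_neighbour hc hd
      simp [this]
    congr 1
    · push_cast; rfl
    · congr 1
      · rw [Finset.sum_congr rfl fun d hd => by rw [hz d hd]]
      · refine Finset.prod_congr rfl fun d hd => ?_
        rw [hz d hd]
        push_cast; rfl
  · rw [integral_const_mul]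
    refine (mul_le_mul_of_nonneg_left hb.2 (by positivity)).trans (le_of_eq ?_)
    have hpow : Real.exp (s * B) ^ Q.card = Real.exp (B / τ ^ 2) := by
      rw [← Real.exp_nat_mul, hQc, hs]
      congr 1
      push_cast
      field_simp
    rw [hpow, hQc]
    push_cast
    field_simp

/-- The risk of the filter is at most the sum of a variance and a bias term. -/
lemma risk_semiOracleYF_le (b : Boundary) {Δ : ℕ} {τ s₀ B : ℝ} (hn : 0 < n) (hΔ : 1 ≤ Δ)
    (hτ : 0 < τ) (hB : 0 ≤ B)
    (hexp : ∀ s, 0 ≤ s → s ≤ s₀ →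
      Integrable (fun z => Real.exp (s * z ^ 2)) (gaussianReal 0 (σ ^ 2)) ∧
        ∫ z, Real.exp (s * z ^ 2) ∂gaussianReal 0 (σ ^ 2) ≤ Real.exp (s * B))
    (hs₀ : 1 / (τ ^ 2 * (2 * Δ + 1) ^ 2) ≤ s₀) {ip : IntegerPart} {h : ℝ → ℝ}
    (hh : IsHolder ip 1 1 h) :
    risk n σ (horizonImage h) (semiOracleYF b Δ τ (pixelMean n (horizonImage h))) ≤
      ENNReal.ofReal ((σ : ℝ) ^ 2 * Real.exp (B / τ ^ 2) / (2 * Δ + 1) ^ 2 +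
        22 * ((σ : ℝ) ^ 2 + 1) * Δ / n) := by
  classical
  have hn' : (0 : ℝ) < n := by exact_mod_cast hn
  set V := (σ : ℝ) ^ 2 * Real.exp (B / τ ^ 2) / (2 * Δ + 1) ^ 2 with hV
  have hV0 : 0 ≤ V := by positivity
  have hex : ∀ p : Fin n × Fin n, ∃ G : (Fin n × Fin n → ℝ) → ℝ, Integrable G (noise n σ) ∧
      (∀ z, (pixelMean n (horizonImage h) p - semiOracleYF b Δ τ (pixelMean n (horizonImage h))
        (pixelMean n (horizonImage h) + z) p) ^ 2 ≤ G z) ∧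
      ∫ z, G z ∂noise n σ ≤ V + ((if Interior Δ p then 0 else (σ : ℝ) ^ 2 + 1) +
        if Crosses h Δ p then (σ : ℝ) ^ 2 + 1 else 0) := by
    intro p
    by_cases hp : Interior Δ p ∧ ¬Crosses h Δ p
    · obtain ⟨G, h1, h2, h3⟩ :=
        exists_error_bound_of_not_crosses (σ := σ) b hτ hB hexp hs₀ h hp.1 hp.2
      exact ⟨G, h1, h2, by simpa [hp.1, hp.2] using h3⟩
    · obtain ⟨G, h1, h2, h3⟩ := exists_error_bound (σ := σ) b Δ τ h p
      refine ⟨G, h1, h2, h3.trans ?_⟩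
      have : (0 : ℝ) ≤ (σ : ℝ) ^ 2 := by positivity
      by_cases hi : Interior Δ p <;> by_cases hcr : Crosses h Δ p <;>
        simp only [hi, hcr, if_true, if_false] <;> first | linarith | exact absurd ⟨hi, hcr⟩ hp
  choose G h1 h2 h3 using hex
  refine (risk_le σ _ _ G _ h1 h2 h3).trans (ENNReal.ofReal_le_ofReal ?_)
  rw [Finset.sum_add_distrib, Finset.sum_add_distrib, Finset.sum_ite, Finset.sum_ite]
  simp only [Finset.sum_const, nsmul_eq_mul, mul_zero, zero_add, add_zero,
    Finset.card_univ, Fintype.card_prod, Fintype.card_fin]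
  have c1 : ((Finset.univ.filter fun p : Fin n × Fin n => ¬Interior Δ p).card : ℝ) ≤
      4 * Δ * n := by
    exact_mod_cast card_not_interior_le Δ _ fun p hp => (Finset.mem_filter.1 hp).2
  have c2 : ((Finset.univ.filter fun p : Fin n × Fin n => Crosses h Δ p).card : ℝ) ≤
      (4 * Δ + 2) * (3 * n) := by
    exact_mod_cast card_crosses_le hh Δ _ fun p hp => (Finset.mem_filter.1 hp).2
  have hΔ' : (1 : ℝ) ≤ Δ := by exact_mod_cast hΔ
  -- Together with the `4Δn` pixels near the border this gives the constant `22 = 4 + 18`.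
  have c3 : (4 * (Δ : ℝ) + 2) * (3 * n) ≤ 18 * Δ * n := by nlinarith
  have hs : (0 : ℝ) ≤ (σ : ℝ) ^ 2 + 1 := by positivity
  push_cast
  calc _ ≤ 1 / (n : ℝ) ^ 2 * (n * n * V + (4 * Δ * n * ((σ : ℝ) ^ 2 + 1) +
        18 * Δ * n * ((σ : ℝ) ^ 2 + 1))) := by
        have c4 := c2.trans c3
        gcongr
    _ = _ := by field_simp; ring

end UpperBound

end HorizonDenoising

/-! ### Balancing variance against bias. -/

open HorizonDenoising in
theorem theorem6 (ip : HorizonDenoising.IntegerPart) (b : HorizonDenoising.Boundary)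
    (α C : ℝ) (hα : 0 < α) (hC : 0 < C) (σ : ℝ≥0) (hσ : 0 < σ)
    (T : Set ℝ) (hT : T.Nonempty) (hT₀ : ∃ τ₀ > 0, ∀ τ ∈ T, τ₀ ≤ τ) :
    HorizonDenoising.SameOrder
      (fun n => ⨅ (τ ∈ T) (Δ : ℕ), ⨆ f ∈ HorizonDenoising.horizonClass ip α C,
        HorizonDenoising.risk n σ f
          (HorizonDenoising.semiOracleYF b Δ τ (HorizonDenoising.pixelMean n f)))
      (fun n => (n : ℝ) ^ (-(2 / 3) : ℝ)) := by
  obtain ⟨τ₀, hτ₀, hT₀⟩ := hT₀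
  obtain ⟨τ₁, hτ₁⟩ := hT
  have hτ₁pos : 0 < τ₁ := hτ₀.trans_le (hT₀ _ hτ₁)
  have hv : σ ^ 2 ≠ 0 := pow_ne_zero 2 hσ.ne'
  obtain ⟨c, hc, hvar⟩ := exists_le_integral_kern_sq hv hτ₀
  obtain ⟨m, hm, hbias⟩ := exists_le_integral_kern_add_one hv hτ₀
  obtain ⟨s₀, hs₀, B, hB, hexp⟩ := exists_integral_exp_sq_le (v := σ ^ 2)
  -- With `M ≤ n^(1/3)`, the first entry settles the roundings and the second makes the tilt at most
  -- `s₀`.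
  set M := max 2 (1 / (τ₁ ^ 2 * s₀)) with hM
  refine ⟨min (c / 9) ((m / 9) ^ 2 / 2), (σ : ℝ) ^ 2 * Real.exp (B / τ₁ ^ 2) +
    44 * ((σ : ℝ) ^ 2 + 1), by positivity, by positivity, ⌈M ^ 3⌉₊, fun n hn => ?_⟩
  have hnM : M ^ 3 ≤ n := (Nat.le_ceil _).trans (by exact_mod_cast hn.le)
  set u : ℝ := (n : ℝ) ^ (1 / 3 : ℝ) with hu
  have hu0 : 0 ≤ u := by positivity
  have hu3 : u ^ 3 = n := by
    rw [hu, ← Real.rpow_natCast, ← Real.rpow_mul (by positivity)]; norm_num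
  have huM : M ≤ u := le_of_pow_le_pow_left₀ three_ne_zero hu0 (by rw [hu3]; exact hnM)
  have hu2 : 2 ≤ u := (le_max_left _ _).trans huM
  have hupos : 0 < u := by linarith
  have hrate : (n : ℝ) ^ (-(2 / 3) : ℝ) = 1 / u ^ 2 := by
    rw [hu, ← Real.rpow_natCast, ← Real.rpow_mul (by positivity), one_div,
      ← Real.rpow_neg (by positivity)]
    norm_num
  have hn0 : 0 < n := by omega
  have hn2 : 8 ≤ n := by
    have : (8 : ℝ) ≤ n := by rw [← hu3]; nlinarith [pow_le_pow_left₀ (by norm_num) hu2 3]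
    exact_mod_cast this
  simp only [hrate]
  constructor
  · refine le_iInf₂ fun τ hτ => le_iInf fun Δ => ?_
    have hτ' := hT₀ τ hτ
    have hτpos := hτ₀.trans_le hτ'
    -- For small windows the variance dominates, since `2Δ + 1 ≤ 3u`; for large ones the bias does,
    -- on `⌈u/2⌉` rows above the middle of the image.
    by_cases hΔ : (Δ : ℝ) < u
    · refine le_trans ?_ (le_iSup₂_of_le _ (horizonImage_const_mem ip α hC.le (-1)) le_rfl)
      refine le_trans (ENNReal.ofReal_le_ofReal ?_)
        (le_risk_empty_image b Δ hn0 hτpos hc.le (hvar τ hτ'))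
      calc min (c / 9) ((m / 9) ^ 2 / 2) * (1 / u ^ 2) ≤ c / 9 * (1 / u ^ 2) := by
            gcongr; exact min_le_left _ _
        _ = c / (3 * u) ^ 2 := by field_simp; norm_num
        _ ≤ _ := by gcongr; linarith
    · push Not at hΔ
      refine le_trans ?_ (le_iSup₂_of_le _
        (horizonImage_const_mem ip α hC.le (((n / 2 : ℕ) : ℝ) / n)) le_rfl)
      have hD1 : u / 2 ≤ ⌈u / 2⌉₊ := Nat.le_ceil _
      have hD2 : (⌈u / 2⌉₊ : ℝ) < u / 2 + 1 := Nat.ceil_lt_add_one (by positivity)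
      have hΔ1 : 1 ≤ Δ := by
        have : (1 : ℝ) ≤ Δ := by linarith
        exact_mod_cast this
      have hDΔ : 2 * (⌈u / 2⌉₊ - 1) ≤ Δ := by
        have : 2 * (⌈u / 2⌉₊ : ℝ) < Δ + 2 := by linarith
        have : 2 * ⌈u / 2⌉₊ < Δ + 2 := by exact_mod_cast this
        omega
      have hDn : n / 2 + ⌈u / 2⌉₊ ≤ n := by
        have : 2 * (⌈u / 2⌉₊ : ℝ) ≤ n := by
          rw [← hu3]
          nlinarith [mul_nonneg hu0 (mul_nonneg hu0 hu0), mul_nonneg hu0 (sub_nonneg.2 hu2),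
            mul_nonneg (mul_nonneg hu0 hu0) (sub_nonneg.2 hu2)]
        have : 2 * ⌈u / 2⌉₊ ≤ n := by exact_mod_cast this
        omega
      refine le_trans (ENNReal.ofReal_le_ofReal ?_)
        (le_risk_horizontal_edge b hτpos hm.le (hbias τ hτ') hΔ1 (by omega) hDΔ hDn)
      calc min (c / 9) ((m / 9) ^ 2 / 2) * (1 / u ^ 2) ≤ (m / 9) ^ 2 / 2 * (1 / u ^ 2) := by
            gcongr; exact min_le_right _ _
        _ = u / 2 * (m / 9) ^ 2 / n := by rw [← hu3]; field_simp
        _ ≤ _ := by gcongr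
  · have hD1 : u ≤ ⌈u⌉₊ := Nat.le_ceil _
    have hD2 : (⌈u⌉₊ : ℝ) < u + 1 := Nat.ceil_lt_add_one hu0
    -- `Δ = ⌈u⌉` balances `Δ⁻²` against `Δ/n`. The bound `⌈u⌉ ≤ 2u` turns the constant 22 into 44.
    refine iInf₂_le_of_le τ₁ hτ₁ (iInf_le_of_le ⌈u⌉₊ (iSup₂_le ?_))
    rintro f ⟨h, -, hh, rfl⟩
    have hΔ1 : 1 ≤ ⌈u⌉₊ := by
      have : (1 : ℝ) ≤ ⌈u⌉₊ := by linarith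
      exact_mod_cast this
    have hN : u ^ 2 ≤ (2 * (⌈u⌉₊ : ℝ) + 1) ^ 2 := by gcongr; linarith
    refine (risk_semiOracleYF_le b hn0 hΔ1 hτ₁pos hB hexp ?_ hh).trans
      (ENNReal.ofReal_le_ofReal ?_)
    · have h1 : 1 / (τ₁ ^ 2 * s₀) ≤ u := (le_max_right _ _).trans huM
      have h2 : 1 / (τ₁ ^ 2 * s₀) ≤ (2 * (⌈u⌉₊ : ℝ) + 1) ^ 2 := by nlinarith
      rw [div_le_iff₀ (by positivity)] at h2 ⊢
      linarith
    · calc _ ≤ (σ : ℝ) ^ 2 * Real.exp (B / τ₁ ^ 2) / u ^ 2 +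
            22 * ((σ : ℝ) ^ 2 + 1) * (2 * u) / n := by
            gcongr
            linarith
        _ = _ := by rw [← hu3]; field_simp; ring
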